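/- Let $d\ge 1$. A quasi-Banach function space $X$ over $\mathbf{R}^d$ is a complete quasi-normed vector space of (a.e. classes of) measurable functions on $\mathbf{R}^d$ with Lebesgue measure such that (ideal property) $f\in X$, $g$ measurable and $|g|\le|f|$ a.e. imply $g\in X$ and $\|g\|_X\le\|f\|_X$, and (saturation) every measurable $E$ with $|E|>0$ contains a measurable $F$ with $|F|>0$ and $\mathbf{1}_F\in X$. It has the Fatou property if, whenever $f_n\in X$, $0\le f_n\uparrow f$ a.e. and $\sup_n\|f_n\|_X<\infty$, then $f\in X$ and $\|f\|_X=\sup_n\|f_n\|_X$. The Köthe dual is $X':=\{g: fg\in L^1(\mathbf{R}^d)\text{ for all }f\in X\}$ with $\|g\|_{X'}:=\sup_{\|f\|_X=1}\int|fg|\,dx$, and for $p>0$ we put $X^p:=\{f:|f|^{1/p}\in X\}$ with $\|f\|_{X^p}:=\||f|^{1/p}\|_X^p$. Cubes have sides parallel to the coordinate axes and positive side length; $\langle f\rangle_{1,Q}:=\frac{1}{|Q|}\int_Q|f|\,dx$, and $Mf:=\sup_Q\langle f\rangle_{1,Q}\mathbf{1}_Q$ is the Hardy--Littlewood maximal operator.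 We write $M:X\to X$ if $M$ maps $X$ into $X$ and $\|Mf\|_X\le C\|f\|_X$ for some $C<\infty$ and all $f\in X$; the least such $C$ is $\|M\|_{X\to X}$. A collection $\mathcal{S}$ of cubes is sparse if there are pairwise disjoint measurable sets $E_Q\subseteq Q$ $(Q\in\mathcal{S})$ with $|E_Q|\ge\frac12|Q|$; put $A_{\mathcal{S}}f:=\sum_{Q\in\mathcal{S}}\langle f\rangle_{1,Q}\mathbf{1}_Q$. A quasi-Banach function space $X$ belongs to $A_{\text{sparse}}$ if there is $C<\infty$ such that, for all sparse $\mathcal{S}$ and all $f\in X$, $A_{\mathcal{S}}f\in X$ and $\|A_{\mathcal{S}}f\|_X\le C\|f\|_X$; the least such $C$ is $[X]_{A_{\text{sparse}}}$. Theorem. There is a constant $c_d>0$ depending only on $d$ such that the following holds. Let $X$ be a quasi-Banach function space over $\mathbf{R}^d$ with the Fatou property and suppose that $M:X\to X$. Then for every $0<\theta<1$: (a) $M:(X')^\theta\to(X')^\theta$ with $\|M\|_{(X')^\theta\to(X')^\theta}\le c_d\,\frac{1}{1-\theta}\,\|M\|_{X\to X}^{\theta}$; (b) $M:[(X')^\theta]'\to[(X')^\theta]'$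 with $\|M\|_{[(X')^\theta]'\to[(X')^\theta]'}\le c_d\,\frac1\theta\,\|M\|_{X\to X}$; (c) $(X')^\theta$ is a quasi-Banach function space and belongs to $A_{\text{sparse}}$, with $[(X')^\theta]_{A_{\text{sparse}}}\le c_d\,\frac1\theta\,\frac{1}{1-\theta}\,\|M\|_{X\to X}^{1+\theta}$. -/

import Mathlib

open MeasureTheory Filter Topology
open scoped ENNReal NNReal

/-- A set of (classes of) measurable functions on `Ω`, together with an extended-real "size" for
each function.  Only the values of `nrm` on `carrier` are meaningful. This is the raw data of a
function space; the axioms are in `IsQuasiBanach`. -/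
structure FunctionSpace {Ω : Type*} [MeasurableSpace Ω] (𝕜 : Type*) [RCLike 𝕜]
    (μ : Measure Ω) where
  carrier : Set (Ω →ₘ[μ] 𝕜)
  nrm : (Ω →ₘ[μ] 𝕜) → ℝ≥0∞

namespace FunctionSpace

section General

variable {Ω : Type*} [MeasurableSpace Ω] {𝕜 : Type*} [RCLike 𝕜] {μ : Measure Ω}

/-- The measurable function `f` is (a.e. equal to) the `[0, ∞]`-valued function `u`; in particular
`u` is finite a.e. -/
def Represents (f : Ω →ₘ[μ] 𝕜) (u : Ω → ℝ≥0∞) : Prop :=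
  ∀ᵐ x ∂μ, u x ≠ ∞ ∧ f x = (((u x).toReal : ℝ) : 𝕜)

/-- `X` is a quasi-Banach function space over `(Ω, μ)`: a complete quasi-normed vector space of
measurable functions with the ideal property and the saturation property. -/
structure IsQuasiBanach (X : FunctionSpace 𝕜 μ) : Prop where
  zero_mem : 0 ∈ X.carrier
  add_mem : ∀ f ∈ X.carrier, ∀ g ∈ X.carrier, f + g ∈ X.carrier
  smul_mem : ∀ (c : 𝕜), ∀ f ∈ X.carrier, c • f ∈ X.carrier
  nrm_lt_top : ∀ f ∈ X.carrier, X.nrm f < ∞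
  nrm_eq_zero_iff : ∀ f ∈ X.carrier, X.nrm f = 0 ↔ f = 0
  nrm_smul : ∀ (c : 𝕜), ∀ f ∈ X.carrier, X.nrm (c • f) = ‖c‖ₑ * X.nrm f
  nrm_add_le : ∃ K : ℝ≥0, ∀ f ∈ X.carrier, ∀ g ∈ X.carrier,
    X.nrm (f + g) ≤ K * (X.nrm f + X.nrm g)
  complete : ∀ u : ℕ → (Ω →ₘ[μ] 𝕜), (∀ n, u n ∈ X.carrier) →
    (∀ ε : ℝ≥0∞, 0 < ε → ∃ N, ∀ m ≥ N, ∀ n ≥ N, X.nrm (u m - u n) < ε) →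
    ∃ f ∈ X.carrier, Tendsto (fun n => X.nrm (u n - f)) atTop (𝓝 0)
  ideal : ∀ f ∈ X.carrier, ∀ g : Ω →ₘ[μ] 𝕜, (∀ᵐ x ∂μ, ‖g x‖ ≤ ‖f x‖) →
    g ∈ X.carrier ∧ X.nrm g ≤ X.nrm f
  saturation : ∀ E : Set Ω, MeasurableSet E → 0 < μ E →
    ∃ F : Set Ω, F ⊆ E ∧ MeasurableSet F ∧ 0 < μ F ∧
      ∃ f ∈ X.carrier, Represents f (F.indicator 1)

open scoped ComplexOrder in
/-- The Fatou property: `0 ≤ f_n ↑ f` a.e. with `f_n ∈ X` and `sup ‖f_n‖ < ∞` imply `f ∈ X` and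
`‖f‖ = sup ‖f_n‖`. -/
def HasFatou (X : FunctionSpace 𝕜 μ) : Prop :=
  ∀ (u : ℕ → (Ω →ₘ[μ] 𝕜)) (f : Ω →ₘ[μ] 𝕜), (∀ n, u n ∈ X.carrier) →
    (∀ᵐ x ∂μ, (∀ n, 0 ≤ u n x) ∧ Monotone (fun n => u n x) ∧
      Tendsto (fun n => u n x) atTop (𝓝 (f x))) →
    (⨆ n, X.nrm (u n)) < ∞ →
    f ∈ X.carrier ∧ X.nrm f = ⨆ n, X.nrm (u n)

/-- The Köthe dual: all `g` with `f g ∈ L¹` for every `f ∈ X`, with the norm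
`sup {∫ |f g| : ‖f‖_X = 1}`. -/
noncomputable def koetheDual (X : FunctionSpace 𝕜 μ) : FunctionSpace 𝕜 μ where
  carrier := {g | ∀ f ∈ X.carrier, Integrable (fun x => f x * g x) μ}
  nrm g := ⨆ (f : Ω →ₘ[μ] 𝕜) (_ : f ∈ X.carrier) (_ : X.nrm f = 1), ∫⁻ x, ‖f x * g x‖ₑ ∂μ

/-- The function `|f|^r`. -/
noncomputable def absPow (r : ℝ) (f : Ω →ₘ[μ] 𝕜) : Ω →ₘ[μ] 𝕜 :=
  AEEqFun.mk (fun x => ((‖f x‖ ^ r : ℝ) : 𝕜))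
    (RCLike.continuous_ofReal.comp_aestronglyMeasurable
      (f.aestronglyMeasurable.norm.aemeasurable.pow_const r).aestronglyMeasurable)

/-- The `p`-concavification `X^p`: all `f` with `|f|^(1/p) ∈ X`, with `‖f‖ = ‖|f|^(1/p)‖_X^p`. -/
noncomputable def power (X : FunctionSpace 𝕜 μ) (p : ℝ) : FunctionSpace 𝕜 μ where
  carrier := {f | absPow (1 / p) f ∈ X.carrier}
  nrm f := X.nrm (absPow (1 / p) f) ^ p

/-- The operator `T` (with `[0, ∞]`-valued images) maps `X` into `X`, with
`‖T f‖_X ≤ C ‖f‖_X`. -/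
def BoundedWith (X : FunctionSpace 𝕜 μ) (T : (Ω →ₘ[μ] 𝕜) → Ω → ℝ≥0∞) (C : ℝ≥0∞) : Prop :=
  ∀ f ∈ X.carrier, ∃ h ∈ X.carrier, Represents h (T f) ∧ X.nrm h ≤ C * X.nrm f

/-- `T : X → X` is bounded. -/
def Bounded (X : FunctionSpace 𝕜 μ) (T : (Ω →ₘ[μ] 𝕜) → Ω → ℝ≥0∞) : Prop :=
  ∃ C : ℝ≥0, X.BoundedWith T C

/-- The operator norm `‖T‖_{X → X}`, which is `∞` if `T` is not bounded on `X`. -/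
noncomputable def opNorm (X : FunctionSpace 𝕜 μ) (T : (Ω →ₘ[μ] 𝕜) → Ω → ℝ≥0∞) : ℝ≥0∞ :=
  sInf {C | X.BoundedWith T C}

end General

end FunctionSpace

/-- An axis-parallel cube in `ℝ^d`, of positive side length. -/
structure Cube (d : ℕ) where
  corner : Fin d → ℝ
  side : ℝ
  side_pos : 0 < side

namespace Cube

variable {d : ℕ}

/-- The points of the cube `∏ [aᵢ, aᵢ + ℓ)`. -/
def toSet (Q : Cube d) : Set (Fin d → ℝ) :=
  Set.univ.pi fun i => Set.Ico (Q.corner i) (Q.corner i + Q.side)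

/-- A collection `S` of cubes is `η`-sparse if there are pairwise disjoint measurable subsets
`E_Q ⊆ Q`, `Q ∈ S`, with `|E_Q| ≥ η |Q|`. -/
def IsSparseWith (η : ℝ) (S : Set (Cube d)) : Prop :=
  ∃ E : Cube d → Set (Fin d → ℝ), S.PairwiseDisjoint E ∧
    ∀ Q ∈ S, MeasurableSet (E Q) ∧ E Q ⊆ Q.toSet ∧
      ENNReal.ofReal η * volume Q.toSet ≤ volume (E Q)

/-- Sparse means `1/2`-sparse. -/
def IsSparse (S : Set (Cube d)) : Prop := IsSparseWith (1 / 2) S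

variable {𝕜 : Type*} [RCLike 𝕜]

/-- The average of `|f|` over the cube `Q`. -/
noncomputable def avg (f : (Fin d → ℝ) →ₘ[volume] 𝕜) (Q : Cube d) : ℝ≥0∞ :=
  (volume Q.toSet)⁻¹ * ∫⁻ x in Q.toSet, ‖f x‖ₑ

end Cube

section Operators

variable {d : ℕ} {𝕜 : Type*} [RCLike 𝕜]

/-- The (uncentered, over cubes) Hardy–Littlewood maximal operator. -/
noncomputable def maximalOp (f : (Fin d → ℝ) →ₘ[volume] 𝕜) : (Fin d → ℝ) → ℝ≥0∞ :=
  fun x => ⨆ Q : Cube d, Q.toSet.indicator (fun _ => Q.avg f) x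

/-- The averaging operator `A_S f = ∑_{Q ∈ S} ⟨|f|⟩_Q 1_Q`. -/
noncomputable def averagingOp (S : Set (Cube d)) (f : (Fin d → ℝ) →ₘ[volume] 𝕜) :
    (Fin d → ℝ) → ℝ≥0∞ :=
  fun x => ∑' Q : S, (Q : Cube d).toSet.indicator (fun _ => (Q : Cube d).avg f) x

end Operators

namespace FunctionSpace

variable {d : ℕ} {𝕜 : Type*} [RCLike 𝕜]

/-- The operators `A_S`, over all sparse collections `S`, are bounded on `X` with constant `C`. -/
def SparseBoundedWith (X : FunctionSpace 𝕜 (volume : Measure (Fin d → ℝ))) (C : ℝ≥0∞) : Prop :=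
  ∀ S : Set (Cube d), Cube.IsSparse S → X.BoundedWith (averagingOp S) C

/-- The sparse Muckenhoupt condition `X ∈ A_sparse`: `X` is a quasi-Banach function space on which
the operators `A_S` are bounded uniformly over all sparse collections `S`. -/
def MemASparse (X : FunctionSpace 𝕜 (volume : Measure (Fin d → ℝ))) : Prop :=
  X.IsQuasiBanach ∧ ∃ C : ℝ≥0, X.SparseBoundedWith C

/-- The constant `[X]_{A_sparse}`. -/
noncomputable def sparseConst (X : FunctionSpace 𝕜 (volume : Measure (Fin d → ℝ))) : ℝ≥0∞ :=
  sInf {C | X.SparseBoundedWith C}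

end FunctionSpace

/-! Put p = 1/θ and B = ‖M‖ on X. Unwinding the Köthe dual, the norm of f in (X')^θ is the supremum
of (∫ |f|^p |k|)^(1/p) over the unit ball of X. So the space is governed by a supremum of weighted
L^p norms (`supNorm`) over a class W of weights such that Mk ≤ B k' a.e. for some k' in W whenever k
is in W (`IsMaximalClass`). The quasi-triangle constant of X never enters the estimates.

(a) The Fefferman–Stein inequality bounds ∫ (Mh)^p k by a constant times ∫ h^p Mk, and Mk ≤ B k'
returns to the class. The p-th root turns B into B^θ, and p/(p-1) = 1/(1-θ).

(b) On the dual side, a finite grid maximal function of g is at most a sum of averages times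
indicators of disjoint sets F_q ⊆ Q_q. Pairing with f moves the problem to the adjoint φ = ∑ |Q_q|⁻¹
(∫_{F_q} f) 1_{Q_q}, to be bounded in `supNorm` (`IsMaximalClass.supNorm_adjoint_le`). Rubio de
Francia iteration inside W replaces the weight k by a majorant w with Mw ≤ 2Bw. Writing ∫ φ^p w = ∫
φ φ^(p-1) w, averages of w are absorbed into 2Bw and what remains is the w-weighted grid maximal
function of φ^(p-1). It is bounded on L^(p')(w) independently of w, with a constant comparable to p
= 1/θ. Hölder and division by a power of ∫ φ^p w finish the bound.

(c) Sparseness gives ∫ (A_S f) g ≤ 2 ∫ Mf Mg, so (a) for f and (b) for g, together with a converse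
Hölder argument (`IsMaximalClass.supNorm_le_of_dual`), give twice the product of the two constants.

The maximal inequalities are proved for nested families, where disjoint maximal sets replace any
covering lemma. Passing from all cubes to 2^d shifted grids costs 12^d 2^d. -/

section LaminarFamilies

/-! ### Nested families of sets and linearization of a finite maximum -/

variable {Ω ι : Type*}

/-- Any two members of the family are disjoint or nested. -/
def IsLaminar (A : ι → Set Ω) : Prop :=
  ∀ i j, Disjoint (A i) (A j) ∨ A i ⊆ A j ∨ A j ⊆ A i

/-- This replaces the Vitali covering lemma, without enlarging sets: a new set is dropped if already
covered, and otherwise it evicts the members it contains. -/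
theorem IsLaminar.exists_disjoint_subfamily {A : ι → Set Ω} (hA : IsLaminar A) (s : Finset ι) :
    ∃ t ⊆ s, (t : Set ι).PairwiseDisjoint A ∧ ∀ i ∈ s, ∃ j ∈ t, A i ⊆ A j := by
  classical
  induction s using Finset.induction_on with
  | empty => exact ⟨∅, by simp⟩
  | insert i s hi ih =>
    obtain ⟨t, hts, htd, htc⟩ := ih
    by_cases h : ∃ j ∈ t, A i ⊆ A j
    · refine ⟨t, hts.trans (Finset.subset_insert _ _), htd, fun k hk => ?_⟩
      rcases Finset.mem_insert.1 hk with rfl | hk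
      · exact h
      · exact htc k hk
    · push Not at h
      refine ⟨insert i (t.filter fun j => ¬ A j ⊆ A i), ?_, ?_, ?_⟩
      · exact Finset.insert_subset_insert _ ((Finset.filter_subset _ _).trans hts)
      · rw [Finset.coe_insert, Set.pairwiseDisjoint_insert]
        refine ⟨htd.subset (Finset.coe_subset.2 (Finset.filter_subset _ _)), fun j hj _ => ?_⟩
        have hj' := Finset.mem_filter.1 (Finset.mem_coe.1 hj)
        rcases hA i j with h1 | h1 | h1
        · exact h1
        · exact absurd h1 (h j hj'.1)
        · exact absurd h1 hj'.2
      · intro k hk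
        rcases Finset.mem_insert.1 hk with rfl | hk
        · exact ⟨k, Finset.mem_insert_self _ _, le_rfl⟩
        · obtain ⟨j, hj, hkj⟩ := htc k hk
          by_cases hji : A j ⊆ A i
          · exact ⟨i, Finset.mem_insert_self _ _, hkj.trans hji⟩
          · exact ⟨j, Finset.mem_insert_of_mem (Finset.mem_filter.2 ⟨hj, hji⟩), hkj⟩

/-- A finite maximum of multiples of indicators is dominated by the sum of the same multiples of
indicators of disjoint subsets. -/
theorem exists_disjoint_subsets_iSup_le_sum [MeasurableSpace Ω] (s : Finset ι) (A : ι → Set Ω)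
    (hA : ∀ i, MeasurableSet (A i)) (a : ι → ℝ≥0∞) :
    ∃ F : ι → Set Ω, (∀ i, MeasurableSet (F i)) ∧ (∀ i, F i ⊆ A i) ∧
      (s : Set ι).PairwiseDisjoint F ∧
      ∀ x, ⨆ i ∈ s, (A i).indicator (fun _ => a i) x ≤ ∑ i ∈ s, (F i).indicator (fun _ => a i) x := by
  classical
  induction s using Finset.induction_on with
  | empty => exact ⟨fun _ => ∅, by simp⟩
  | insert i s hi ih =>
    obtain ⟨F, hFm, hFA, hFd, hF⟩ := ih
    -- The part of the new set where its coefficient is at least the sum built so far; there it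
    -- takes over, and the older sets give up E to stay disjoint.
    set E : Set Ω := A i ∩ {x | ∑ j ∈ s, (F j).indicator (fun _ => a j) x ≤ a i} with hE
    have hEm : MeasurableSet E := by
      refine (hA i).inter (measurableSet_le ?_ measurable_const)
      exact Finset.measurable_sum _ fun j _ => measurable_const.indicator (hFm j)
    have hne : ∀ j ∈ s, j ≠ i := fun j hj h => hi (h ▸ hj)
    refine ⟨fun j => if j = i then E else F j \ E, ?_, ?_, ?_, ?_⟩
    · intro j; dsimp only; split_ifs
      · exact hEm
      · exact (hFm j).diff hEm
    · intro j; dsimp only; split_ifs with h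
      · exact h ▸ Set.inter_subset_left
      · exact Set.sdiff_subset.trans (hFA j)
    · rw [Finset.coe_insert, Set.pairwiseDisjoint_insert]
      refine ⟨fun j hj k hk hjk => ?_, fun j hj _ => ?_⟩
      · simp only [Function.onFun, hne j hj, hne k hk, if_false]
        exact (hFd hj hk hjk).mono Set.sdiff_subset Set.sdiff_subset
      · simp only [hne j hj, if_true, if_false]
        exact Set.disjoint_sdiff_right
    · intro x
      rw [Finset.iSup_insert, Finset.sum_insert hi]
      simp only [if_true]
      by_cases hx : x ∈ E
      · rw [Set.indicator_of_mem hx, Set.indicator_of_mem hx.1]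
        refine (sup_le le_rfl ((hF x).trans hx.2)).trans le_self_add
      · rw [Set.indicator_of_notMem hx, zero_add]
        have h1 : ∑ j ∈ s, (if j = i then E else F j \ E).indicator (fun _ => a j) x
            = ∑ j ∈ s, (F j).indicator (fun _ => a j) x := by
          refine Finset.sum_congr rfl fun j hj => ?_
          simp only [hne j hj, if_false, Set.indicator, Set.mem_sdiff, hx, not_false_eq_true,
            and_true]
        rw [h1]
        refine sup_le ?_ (hF x)
        by_cases hxA : x ∈ A i
        · rw [Set.indicator_of_mem hxA]
          by_contra hcon
          exact hx ⟨hxA, (not_le.1 hcon).le⟩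
        · rw [Set.indicator_of_notMem hxA]; exact zero_le

end LaminarFamilies

/-! ### Layer-cake formula for extended-valued functions -/

section LayerCake

variable {Ω : Type*} [MeasurableSpace Ω]

theorem lintegral_rpow_eq_of_lt_top (ν : Measure Ω) {u : Ω → ℝ≥0∞} (hu : AEMeasurable u ν)
    (hfin : ∀ᵐ x ∂ν, u x ≠ ∞) {p : ℝ} (hp : 0 < p) :
    ∫⁻ x, u x ^ p ∂ν = ENNReal.ofReal p *
      ∫⁻ t in Set.Ioi (0 : ℝ), ν {x | ENNReal.ofReal t < u x} * ENNReal.ofReal (t ^ (p - 1)) := by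
  have h := lintegral_rpow_eq_lintegral_meas_lt_mul ν (f := fun x => (u x).toReal)
    (ae_of_all _ fun x => ENNReal.toReal_nonneg) hu.ennreal_toReal hp
  have h1 : ∫⁻ x, u x ^ p ∂ν = ∫⁻ x, ENNReal.ofReal ((u x).toReal ^ p) ∂ν := by
    refine lintegral_congr_ae ?_
    filter_upwards [hfin] with x hx
    rw [← ENNReal.ofReal_rpow_of_nonneg ENNReal.toReal_nonneg hp.le, ENNReal.ofReal_toReal hx]
  rw [h1, h]
  congr 1
  refine setLIntegral_congr_fun measurableSet_Ioi fun t ht => ?_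
  congr 1
  refine measure_congr ?_
  filter_upwards [hfin] with x hx
  exact propext (ENNReal.ofReal_lt_iff_lt_toReal (le_of_lt ht) hx).symm

/-- No finiteness of u is assumed: the formula is applied to the truncations min(u, n), followed by
monotone convergence. -/
theorem lintegral_rpow_le_lintegral_meas_lt (ν : Measure Ω) {u : Ω → ℝ≥0∞} (hu : Measurable u)
    {p : ℝ} (hp : 0 < p) :
    ∫⁻ x, u x ^ p ∂ν ≤ ENNReal.ofReal p *
      ∫⁻ t in Set.Ioi (0 : ℝ), ν {x | ENNReal.ofReal t < u x} * ENNReal.ofReal (t ^ (p - 1)) := by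
  have h1 : ∀ x, u x ^ p = ⨆ n : ℕ, (min (u x) n) ^ p := by
    intro x
    have h := (ENNReal.orderIsoRpow p hp).map_iSup (fun n : ℕ => min (u x) n)
    simp only [ENNReal.orderIsoRpow_apply] at h
    rw [← h, ← inf_iSup_eq, ENNReal.iSup_natCast, inf_top_eq]
  simp_rw [h1]
  rw [lintegral_iSup (fun n => (hu.min measurable_const).pow_const p)]
  · refine iSup_le fun n => ?_
    rw [lintegral_rpow_eq_of_lt_top ν (hu.min measurable_const).aemeasurable
      (ae_of_all _ fun x => ((min_le_right _ _).trans_lt (ENNReal.natCast_lt_top n)).ne) hp]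
    gcongr with t x
    exact min_le_left _ _
  · intro m n hmn x
    dsimp only
    gcongr

theorem lintegral_meas_lt_le_lintegral_rpow (ν : Measure Ω) {u : Ω → ℝ≥0∞} (hu : Measurable u)
    {p : ℝ} (hp : 0 < p) :
    ENNReal.ofReal p *
      ∫⁻ t in Set.Ioi (0 : ℝ), ν {x | ENNReal.ofReal t < u x} * ENNReal.ofReal (t ^ (p - 1)) ≤
      ∫⁻ x, u x ^ p ∂ν := by
  by_cases h : ∫⁻ x, u x ^ p ∂ν = ∞
  · rw [h]; exact le_top
  · refine (lintegral_rpow_eq_of_lt_top ν hu.aemeasurable ?_ hp).ge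
    filter_upwards [ae_lt_top (hu.pow_const p) h] with x hx hx'
    rw [hx', ENNReal.top_rpow_of_pos hp] at hx
    exact lt_irrefl _ hx

end LayerCake

/-! ### Two-measure maximal inequalities for nested families -/

section LaminarMaximal

variable {Ω ι : Type*} [MeasurableSpace Ω]

/-- The maximal operator of a finite family of sets `A i`, with normalizations `m i`. -/
noncomputable def finMax (μ : Measure Ω) (A : ι → Set Ω) (m : ι → ℝ≥0∞) (s : Finset ι)
    (h : Ω → ℝ≥0∞) (x : Ω) : ℝ≥0∞ :=
  ⨆ i ∈ s, (A i).indicator (fun _ => (m i)⁻¹ * ∫⁻ y in A i, h y ∂μ) x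

theorem measurable_finMax (μ : Measure Ω) {A : ι → Set Ω} (hA : ∀ i, MeasurableSet (A i))
    (m : ι → ℝ≥0∞) (s : Finset ι) (h : Ω → ℝ≥0∞) : Measurable (finMax μ A m s h) :=
  Measurable.biSup _ s.countable_toSet fun i _ => measurable_const.indicator (hA i)

variable {μ ν : Measure Ω} {A : ι → Set Ω} {m : ι → ℝ≥0∞} {u : Ω → ℝ≥0∞}

/-- The function u stands for a maximal function of ν relative to μ: on each A i, the ratio ν(A i)/m
i is at most u. Hence a ν(A i) ≤ ∫ h u over A i, and summing over disjoint maximal sets costs no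
constant. -/
theorem mul_measure_biUnion_le (hlam : IsLaminar A) (hA : ∀ i, MeasurableSet (A i))
    (hm0 : ∀ i, m i ≠ 0) (hmt : ∀ i, m i ≠ ∞)
    (hν : ∀ i, ∀ᵐ x ∂μ, x ∈ A i → ν (A i) ≤ m i * u x)
    (s : Finset ι) {h : Ω → ℝ≥0∞} (hh : Measurable h) (hu : Measurable u) {a : ℝ≥0∞}
    (hs : ∀ i ∈ s, a * m i ≤ ∫⁻ y in A i, h y ∂μ) :
    a * ν (⋃ i ∈ s, A i) ≤ ∫⁻ x, h x * u x ∂μ := by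
  obtain ⟨t, hts, htd, htc⟩ := hlam.exists_disjoint_subfamily s
  have h1 : ∀ i ∈ s, a * ν (A i) ≤ ∫⁻ x in A i, h x * u x ∂μ := by
    intro i hi
    have h2 : m i * (a * ν (A i)) ≤ m i * ∫⁻ x in A i, h x * u x ∂μ := by
      calc m i * (a * ν (A i)) = (a * m i) * ν (A i) := by ring
        _ ≤ (∫⁻ y in A i, h y ∂μ) * ν (A i) := by gcongr; exact hs i hi
        _ = ∫⁻ y in A i, h y * ν (A i) ∂μ := (lintegral_mul_const _ hh).symm
        _ ≤ ∫⁻ y in A i, m i * (h y * u y) ∂μ := by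
          refine setLIntegral_mono_ae (measurable_const.mul (hh.mul hu)).aemeasurable ?_
          filter_upwards [hν i] with x hx hxA
          calc h x * ν (A i) ≤ h x * (m i * u x) := by gcongr; exact hx hxA
            _ = m i * (h x * u x) := by ring
        _ = m i * ∫⁻ x in A i, h x * u x ∂μ := lintegral_const_mul _ (hh.mul hu)
    exact (ENNReal.mul_le_mul_iff_right (hm0 i) (hmt i)).1 h2
  calc a * ν (⋃ i ∈ s, A i) ≤ a * ν (⋃ i ∈ t, A i) := by
        gcongr a * ν ?_
        refine Set.iUnion₂_subset fun i hi => ?_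
        obtain ⟨j, hj, hij⟩ := htc i hi
        exact hij.trans (Set.subset_biUnion_of_mem (u := fun i => A i) hj)
    _ ≤ a * ∑ i ∈ t, ν (A i) := by gcongr; exact measure_biUnion_finset_le _ _
    _ = ∑ i ∈ t, a * ν (A i) := Finset.mul_sum _ _ _
    _ ≤ ∑ i ∈ t, ∫⁻ x in A i, h x * u x ∂μ := Finset.sum_le_sum fun i hi => h1 i (hts hi)
    _ = ∫⁻ x in ⋃ i ∈ t, A i, h x * u x ∂μ :=
        (lintegral_biUnion_finset htd (fun i _ => hA i) _).symm
    _ ≤ ∫⁻ x, h x * u x ∂μ := setLIntegral_le_lintegral _ _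

/-- Where h ≤ a it contributes at most a to each average, since μ(A i) ≤ m i. So an average above 2a
leaves at least a for the part of h above level a. -/
theorem finMax_weak_type (hlam : IsLaminar A) (hA : ∀ i, MeasurableSet (A i))
    (hm0 : ∀ i, m i ≠ 0) (hmt : ∀ i, m i ≠ ∞) (hμ : ∀ i, μ (A i) ≤ m i)
    (hν : ∀ i, ∀ᵐ x ∂μ, x ∈ A i → ν (A i) ≤ m i * u x)
    (s : Finset ι) {h : Ω → ℝ≥0∞} (hh : Measurable h) (hu : Measurable u) {a : ℝ≥0∞}
    (hat : a ≠ ∞) :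
    a * ν {x | 2 * a < finMax μ A m s h x} ≤ ∫⁻ x in {x | a < h x}, h x * u x ∂μ := by
  classical
  have hS : MeasurableSet {x | a < h x} := measurableSet_lt measurable_const hh
  set g : Ω → ℝ≥0∞ := {x | a < h x}.indicator h with hg
  have hgm : Measurable g := hh.indicator hS
  set s' := s.filter fun i => a * m i ≤ ∫⁻ y in A i, g y ∂μ with hs'
  have hsub : {x | 2 * a < finMax μ A m s h x} ⊆ ⋃ i ∈ s', A i := by
    intro x hx
    simp only [finMax, Set.mem_ofPred_eq, lt_iSup_iff] at hx
    obtain ⟨i, hi, hx⟩ := hx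
    have hxA : x ∈ A i := by
      by_contra hxA
      rw [Set.indicator_of_notMem hxA] at hx
      exact not_lt_bot hx
    rw [Set.indicator_of_mem hxA] at hx
    refine Set.mem_biUnion (Finset.mem_filter.2 ⟨hi, ?_⟩) hxA
    have h1 : 2 * a * m i ≤ ∫⁻ y in A i, h y ∂μ := by
      calc 2 * a * m i ≤ ((m i)⁻¹ * ∫⁻ y in A i, h y ∂μ) * m i := by gcongr
        _ = (m i)⁻¹ * m i * ∫⁻ y in A i, h y ∂μ := by ring
        _ = _ := by rw [ENNReal.inv_mul_cancel (hm0 i) (hmt i), one_mul]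
    have h2 : ∫⁻ y in A i, h y ∂μ ≤ ∫⁻ y in A i, g y ∂μ + a * m i := by
      calc ∫⁻ y in A i, h y ∂μ ≤ ∫⁻ y in A i, (g y + a) ∂μ := by
            refine lintegral_mono fun y => ?_
            by_cases hy : a < h y
            · rw [hg, Set.indicator_of_mem (show y ∈ {x | a < h x} from hy)]; exact le_self_add
            · exact (not_lt.1 hy).trans le_add_self
        _ = ∫⁻ y in A i, g y ∂μ + a * μ (A i) := by
            rw [lintegral_add_left hgm, setLIntegral_const]
        _ ≤ _ := by gcongr; exact hμ i
    have h3 : a * m i + a * m i ≤ ∫⁻ y in A i, g y ∂μ + a * m i := by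
      rw [← two_mul, ← mul_assoc]; exact h1.trans h2
    exact (ENNReal.add_le_add_iff_right (ENNReal.mul_ne_top hat (hmt i))).1 h3
  calc a * ν {x | 2 * a < finMax μ A m s h x} ≤ a * ν (⋃ i ∈ s', A i) := by gcongr
    _ ≤ ∫⁻ x, g x * u x ∂μ :=
        mul_measure_biUnion_le hlam hA hm0 hmt hν s' hgm hu fun i hi => (Finset.mem_filter.1 hi).2
    _ = ∫⁻ x in {x | a < h x}, h x * u x ∂μ := by
        rw [← lintegral_indicator hS]
        congr 1 with x
        by_cases hx : x ∈ {x | a < h x} <;> simp [hg, hx]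

/-- The strong type inequality for the maximal operator of a finite laminar family, with two
measures. -/
theorem lintegral_finMax_rpow_le [SFinite μ] (hlam : IsLaminar A) (hA : ∀ i, MeasurableSet (A i))
    (hm0 : ∀ i, m i ≠ 0) (hmt : ∀ i, m i ≠ ∞) (hμ : ∀ i, μ (A i) ≤ m i)
    (hν : ∀ i, ∀ᵐ x ∂μ, x ∈ A i → ν (A i) ≤ m i * u x)
    (s : Finset ι) {h : Ω → ℝ≥0∞} (hh : Measurable h) (hu : Measurable u) {p : ℝ} (hp : 1 < p) :
    ∫⁻ x, finMax μ A m s h x ^ p ∂ν ≤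
      ENNReal.ofReal (2 ^ p * (p / (p - 1))) * ∫⁻ x, h x ^ p * u x ∂μ := by
  have hp0 : 0 < p := by linarith
  have hp1 : 0 < p - 1 := by linarith
  set κ := μ.withDensity fun x => h x * u x with hκ
  -- The weak type bound at a = t/2 trades one power of t for the density h u. A second layer-cake
  -- formula, for 2h with exponent p - 1 under κ, then yields p · 2 · 2^(p-1)/(p-1), which is the
  -- stated constant.
  have key : ∀ t ∈ Set.Ioi (0 : ℝ),
      ν {x | ENNReal.ofReal t < finMax μ A m s h x} * ENNReal.ofReal (t ^ (p - 1)) ≤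
      2 * (κ {x | ENNReal.ofReal t < 2 * h x} * ENNReal.ofReal (t ^ (p - 1 - 1))) := by
    intro t ht
    have ht0 : (0 : ℝ) < t := ht
    have hw := finMax_weak_type hlam hA hm0 hmt hμ hν s hh hu
      (a := ENNReal.ofReal (t / 2)) ENNReal.ofReal_ne_top
    have e1 : 2 * ENNReal.ofReal (t / 2) = ENNReal.ofReal t := by
      rw [← ENNReal.ofReal_ofNat 2, ← ENNReal.ofReal_mul (by norm_num)]; congr 1; ring
    have e2 : {x | ENNReal.ofReal (t / 2) < h x} = {x | ENNReal.ofReal t < 2 * h x} := by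
      ext x
      rw [Set.mem_ofPred_eq, Set.mem_ofPred_eq, ← e1,
        ENNReal.mul_lt_mul_iff_right (by norm_num) (by norm_num)]
    rw [e1, e2, ← withDensity_apply _ (measurableSet_lt measurable_const (hh.const_mul 2))] at hw
    have e3 : ENNReal.ofReal (t ^ (p - 1)) =
        2 * (ENNReal.ofReal (t / 2) * ENNReal.ofReal (t ^ (p - 1 - 1))) := by
      rw [← mul_assoc, e1, ← ENNReal.ofReal_mul ht0.le]
      congr 1
      rw [Real.rpow_sub_one ht0.ne' (p - 1)]; field_simp
    calc ν {x | ENNReal.ofReal t < finMax μ A m s h x} * ENNReal.ofReal (t ^ (p - 1))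
        = 2 * ((ENNReal.ofReal (t / 2) * ν {x | ENNReal.ofReal t < finMax μ A m s h x}) *
          ENNReal.ofReal (t ^ (p - 1 - 1))) := by rw [e3]; ring
      _ ≤ _ := by gcongr
  have hmeas : Measurable fun t : ℝ => κ {x | ENNReal.ofReal t < 2 * h x} := by
    refine Antitone.measurable fun a b hab => measure_mono fun x hx => ?_
    exact (ENNReal.ofReal_le_ofReal hab).trans_lt hx
  calc ∫⁻ x, finMax μ A m s h x ^ p ∂ν
      ≤ ENNReal.ofReal p * ∫⁻ t in Set.Ioi (0 : ℝ),
        ν {x | ENNReal.ofReal t < finMax μ A m s h x} * ENNReal.ofReal (t ^ (p - 1)) :=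
        lintegral_rpow_le_lintegral_meas_lt ν (measurable_finMax μ hA m s h) hp0
    _ ≤ ENNReal.ofReal p * ∫⁻ t in Set.Ioi (0 : ℝ),
        2 * (κ {x | ENNReal.ofReal t < 2 * h x} * ENNReal.ofReal (t ^ (p - 1 - 1))) := by
        gcongr ENNReal.ofReal p * ?_
        exact setLIntegral_mono' measurableSet_Ioi key
    _ = ENNReal.ofReal (2 * (p / (p - 1))) * (ENNReal.ofReal (p - 1) * ∫⁻ t in Set.Ioi (0 : ℝ),
        κ {x | ENNReal.ofReal t < 2 * h x} * ENNReal.ofReal (t ^ (p - 1 - 1))) := by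
        rw [lintegral_const_mul _ (show Measurable fun t : ℝ =>
          κ {x | ENNReal.ofReal t < 2 * h x} * ENNReal.ofReal (t ^ (p - 1 - 1)) from
          hmeas.mul (by fun_prop)), ← mul_assoc, ← mul_assoc,
          ← ENNReal.ofReal_mul (by positivity)]
        congr 1
        rw [← ENNReal.ofReal_ofNat 2, ← ENNReal.ofReal_mul (by positivity)]
        congr 1; field_simp
    _ ≤ ENNReal.ofReal (2 * (p / (p - 1))) * ∫⁻ x, (2 * h x) ^ (p - 1) ∂κ := by
        gcongr
        exact lintegral_meas_lt_le_lintegral_rpow κ (hh.const_mul 2) hp1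
    _ = ENNReal.ofReal (2 * (p / (p - 1))) * ∫⁻ x, 2 ^ (p - 1) * (h x ^ p * u x) ∂μ := by
        rw [hκ, lintegral_withDensity_eq_lintegral_mul _
          (show Measurable fun x => h x * u x by fun_prop) ((hh.const_mul 2).pow_const _)]
        congr 2 with x
        rw [Pi.mul_apply, ENNReal.mul_rpow_of_nonneg _ _ hp1.le]
        have : h x ^ p = h x ^ (p - 1) * h x := by
          conv_lhs => rw [show p = (p - 1) + 1 by ring]
          rw [ENNReal.rpow_add_of_nonneg _ _ hp1.le zero_le_one, ENNReal.rpow_one]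
        rw [this]; ring
    _ = ENNReal.ofReal (2 ^ p * (p / (p - 1))) * ∫⁻ x, h x ^ p * u x ∂μ := by
        rw [lintegral_const_mul _ (show Measurable fun x => h x ^ p * u x by fun_prop), ← mul_assoc]
        congr 1
        rw [← ENNReal.ofReal_ofNat 2, ENNReal.ofReal_rpow_of_pos (by norm_num),
          ← ENNReal.ofReal_mul (by positivity)]
        congr 1
        rw [Real.rpow_sub_one (by norm_num)]; ring

end LaminarMaximal

/-! ### Volumes and averages of cubes -/

namespace Cube

variable {d : ℕ}

theorem measurableSet_toSet (Q : Cube d) : MeasurableSet Q.toSet :=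
  MeasurableSet.univ_pi fun _ => measurableSet_Ico

theorem volume_toSet (Q : Cube d) : volume Q.toSet = ENNReal.ofReal Q.side ^ d := by
  rw [toSet, Real.volume_pi_Ico]
  simp

theorem volume_ne_zero (Q : Cube d) : volume Q.toSet ≠ 0 := by
  rw [volume_toSet]
  exact pow_ne_zero _ (ENNReal.ofReal_pos.2 Q.side_pos).ne'

theorem volume_ne_top (Q : Cube d) : volume Q.toSet ≠ ∞ := by
  rw [volume_toSet]
  exact ENNReal.pow_ne_top ENNReal.ofReal_ne_top

/-- The average of a `[0, ∞]`-valued function over a cube. -/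
noncomputable def lavg (u : (Fin d → ℝ) → ℝ≥0∞) (Q : Cube d) : ℝ≥0∞ :=
  (volume Q.toSet)⁻¹ * ∫⁻ y in Q.toSet, u y

theorem volume_mul_lavg (u : (Fin d → ℝ) → ℝ≥0∞) (Q : Cube d) :
    volume Q.toSet * Q.lavg u = ∫⁻ y in Q.toSet, u y := by
  rw [lavg, ← mul_assoc, ENNReal.mul_inv_cancel Q.volume_ne_zero Q.volume_ne_top, one_mul]

theorem lavg_le_mul_lavg {Q R : Cube d} (h : Q.toSet ⊆ R.toSet) {c : ℝ≥0∞}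
    (hc : volume R.toSet ≤ c * volume Q.toSet) (u : (Fin d → ℝ) → ℝ≥0∞) :
    Q.lavg u ≤ c * R.lavg u := by
  have h1 : volume Q.toSet * Q.lavg u ≤ volume Q.toSet * (c * R.lavg u) := by
    rw [volume_mul_lavg]
    calc ∫⁻ y in Q.toSet, u y ≤ ∫⁻ y in R.toSet, u y := lintegral_mono_set h
      _ = volume R.toSet * R.lavg u := (volume_mul_lavg _ _).symm
      _ ≤ (c * volume Q.toSet) * R.lavg u := by gcongr
      _ = _ := by ring
  exact (ENNReal.mul_le_mul_iff_right Q.volume_ne_zero Q.volume_ne_top).1 h1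

/-- The centered cube of side `2 n + 2`. -/
def box (d n : ℕ) : Cube d where
  corner _ := -(n + 1)
  side := 2 * (n + 1)
  side_pos := by positivity

theorem iUnion_box (d : ℕ) : ⋃ n, (box d n).toSet = Set.univ := by
  refine Set.eq_univ_of_forall fun x => ?_
  obtain ⟨n, hn⟩ := exists_nat_gt ‖x‖
  refine Set.mem_iUnion.2 ⟨n, fun i _ => ?_⟩
  have h1 := (abs_le.1 ((norm_le_pi_norm x i).trans hn.le))
  simp only [box, Set.mem_Ico]
  constructor <;> linarith [h1.1, h1.2, (norm_le_pi_norm x i).trans_lt hn]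

theorem box_mono (d : ℕ) : Monotone fun n => (box d n).toSet := by
  intro m n hmn x hx i _
  have h1 := hx i (Set.mem_univ i)
  have h2 : (m : ℝ) ≤ n := by exact_mod_cast hmn
  simp only [box, Set.mem_Ico] at h1 ⊢
  constructor <;> linarith [h1.1, h1.2]

theorem exists_subset_box (Q : Cube d) : ∃ n, Q.toSet ⊆ (box d n).toSet := by
  obtain ⟨n, hn⟩ := exists_nat_gt (‖Q.corner‖ + Q.side)
  refine ⟨n, fun x hx i _ => ?_⟩
  have h1 := hx i (Set.mem_univ i)
  have h2 := abs_le.1 (norm_le_pi_norm Q.corner i)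
  have h3 := Q.side_pos
  simp only [box, Set.mem_Ico] at h1 ⊢
  constructor <;> linarith [h1.1, h1.2, h2.1, h2.2]

end Cube

/-! ### The maximal function and its measurability -/

section Maximal

variable {d : ℕ}

/-- The maximal function of a `[0, ∞]`-valued function. -/
noncomputable def maxFn (u : (Fin d → ℝ) → ℝ≥0∞) (x : Fin d → ℝ) : ℝ≥0∞ :=
  ⨆ Q : Cube d, Q.toSet.indicator (fun _ => Q.lavg u) x

theorem lavg_le_maxFn (u : (Fin d → ℝ) → ℝ≥0∞) {Q : Cube d} {x : Fin d → ℝ} (hx : x ∈ Q.toSet) :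
    Q.lavg u ≤ maxFn u x :=
  (Set.indicator_of_mem hx (fun _ => Q.lavg u)).symm.le.trans
    (le_iSup (fun Q : Cube d => Q.toSet.indicator (fun _ => Q.lavg u) x) Q)

theorem maxFn_le {u : (Fin d → ℝ) → ℝ≥0∞} {x : Fin d → ℝ} {c : ℝ≥0∞}
    (h : ∀ Q : Cube d, x ∈ Q.toSet → Q.lavg u ≤ c) : maxFn u x ≤ c := by
  refine iSup_le fun Q => ?_
  by_cases hx : x ∈ Q.toSet
  · rw [Set.indicator_of_mem hx]; exact h Q hx
  · rw [Set.indicator_of_notMem hx]; exact zero_le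

theorem maxFn_mono_ae {u v : (Fin d → ℝ) → ℝ≥0∞} (h : ∀ᵐ x, u x ≤ v x) (x : Fin d → ℝ) :
    maxFn u x ≤ maxFn v x :=
  maxFn_le fun Q hx => le_trans (by
    unfold Cube.lavg
    exact mul_le_mul_right (lintegral_mono_ae (ae_restrict_of_ae h)) _) (lavg_le_maxFn v hx)

theorem maxFn_congr_ae {u v : (Fin d → ℝ) → ℝ≥0∞} (h : ∀ᵐ x, u x = v x) : maxFn u = maxFn v :=
  funext fun x => le_antisymm (maxFn_mono_ae (h.mono fun _ => le_of_eq) x)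
    (maxFn_mono_ae (h.mono fun _ => ge_of_eq) x)

theorem maxFn_tsum_le {u : ℕ → (Fin d → ℝ) → ℝ≥0∞} (hu : ∀ j, Measurable (u j)) (x : Fin d → ℝ) :
    maxFn (fun y => ∑' j, u j y) x ≤ ∑' j, maxFn (u j) x := by
  refine maxFn_le fun Q hx => ?_
  rw [Cube.lavg, lintegral_tsum fun j => (hu j).aemeasurable, ← ENNReal.tsum_mul_left]
  exact ENNReal.tsum_le_tsum fun j => lavg_le_maxFn (u j) hx

theorem maxFn_const_mul_le {u : (Fin d → ℝ) → ℝ≥0∞} (hu : Measurable u) (c : ℝ≥0∞)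
    (x : Fin d → ℝ) : maxFn (fun y => c * u y) x ≤ c * maxFn u x := by
  refine maxFn_le fun Q hx => ?_
  rw [Cube.lavg, lintegral_const_mul _ hu, mul_left_comm]
  gcongr
  exact lavg_le_maxFn u hx

/-- A slight enlargement changes the volume continuously and does not decrease the integral. This
makes the maximal function a countable supremum, hence measurable. -/
theorem exists_rat_cube {u : (Fin d → ℝ) → ℝ≥0∞} {Q : Cube d} {c : ℝ≥0∞} (hc : c < Q.lavg u) :
    ∃ (a : Fin d → ℚ) (s : ℚ) (hs : (0 : ℝ) < s),
      Q.toSet ⊆ (⟨fun i => a i, s, hs⟩ : Cube d).toSet ∧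
        c < (⟨fun i => a i, s, hs⟩ : Cube d).lavg u := by
  have hct : c ≠ ∞ := hc.ne_top
  have h1 : c * ENNReal.ofReal (Q.side + 0) ^ d < ∫⁻ y in Q.toSet, u y := by
    rw [add_zero, ← Q.volume_toSet, ← Q.volume_mul_lavg, mul_comm]
    exact ENNReal.mul_lt_mul_right Q.volume_ne_zero Q.volume_ne_top hc
  have hcont : Continuous fun δ : ℝ => c * ENNReal.ofReal (Q.side + δ) ^ d :=
    (ENNReal.continuous_const_mul hct).comp ((ENNReal.continuous_pow d).comp
      (ENNReal.continuous_ofReal.comp (continuous_const.add continuous_id)))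
  have h2 : ∀ᶠ δ in 𝓝[>] (0 : ℝ), c * ENNReal.ofReal (Q.side + δ) ^ d < ∫⁻ y in Q.toSet, u y :=
    (hcont.continuousAt.eventually_lt continuousAt_const h1).filter_mono nhdsWithin_le_nhds
  obtain ⟨δ, hδ, hδ0⟩ := (h2.and self_mem_nhdsWithin).exists
  replace hδ0 : 0 < δ := hδ0
  have hQ := Q.side_pos
  -- The corner moves down by less than δ/2 and the side grows by more than δ/2, so the new cube
  -- still contains Q.
  obtain ⟨s, hs1, hs2⟩ := exists_rat_btwn (show Q.side + δ / 2 < Q.side + δ by linarith)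
  choose a ha1 ha2 using fun i => exists_rat_btwn (show Q.corner i - δ / 2 < Q.corner i by linarith)
  have hs : (0 : ℝ) < s := by linarith
  have hsub : Q.toSet ⊆ (⟨fun i => a i, s, hs⟩ : Cube d).toSet := by
    intro x hx i _
    have h3 := hx i (Set.mem_univ i)
    simp only [Set.mem_Ico] at h3 ⊢
    constructor <;> linarith [h3.1, h3.2, ha1 i, ha2 i]
  refine ⟨a, s, hs, hsub, ?_⟩
  set R : Cube d := ⟨fun i => a i, s, hs⟩
  by_contra hcon
  refine lt_irrefl (∫⁻ y in Q.toSet, u y) ?_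
  calc ∫⁻ y in Q.toSet, u y ≤ ∫⁻ y in R.toSet, u y := lintegral_mono_set hsub
    _ = volume R.toSet * R.lavg u := (R.volume_mul_lavg u).symm
    _ ≤ ENNReal.ofReal (Q.side + δ) ^ d * c := by
      rw [R.volume_toSet]
      gcongr
      exact not_lt.1 hcon
    _ = c * ENNReal.ofReal (Q.side + δ) ^ d := mul_comm _ _
    _ < _ := hδ

/-- The cubes with rational corner and side length. -/
def ratCube (q : (Fin d → ℚ) × {s : ℚ // (0 : ℚ) < s}) : Cube d where
  corner i := q.1 i
  side := q.2
  side_pos := Rat.cast_pos.2 q.2.2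

theorem maxFn_eq_iSup_ratCube (u : (Fin d → ℝ) → ℝ≥0∞) :
    maxFn u = fun x => ⨆ q, (ratCube q).toSet.indicator (fun _ => (ratCube q).lavg u) x := by
  funext x
  refine le_antisymm (maxFn_le fun Q hx => le_of_forall_lt fun c hc => ?_)
    (iSup_le fun q => le_iSup (fun Q : Cube d => Q.toSet.indicator (fun _ => Q.lavg u) x) _)
  obtain ⟨a, s, hs, hsub, hlt⟩ := exists_rat_cube hc
  refine hlt.trans_le (le_trans ?_ (le_iSup
    (fun q => (ratCube q).toSet.indicator (fun _ => (ratCube q).lavg u) x)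
    (a, ⟨s, Rat.cast_pos.1 hs⟩)))
  exact (Set.indicator_of_mem (hsub hx) (fun _ => Cube.lavg u _)).symm.le

theorem measurable_maxFn (u : (Fin d → ℝ) → ℝ≥0∞) : Measurable (maxFn u) := by
  rw [maxFn_eq_iSup_ratCube]
  exact Measurable.iSup fun q => measurable_const.indicator (Cube.measurableSet_toSet _)

end Maximal

/-! ### Shifted grids, the one-third trick and the Fefferman–Stein inequality -/

section Grids

variable {d : ℕ}

/-- The cubes of the base-4 grid in which the coordinates selected by `α` are shifted by a third
of the side length. -/
noncomputable def gridCube (α : Fin d → Bool) (q : ℤ × (Fin d → ℤ)) : Cube d where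
  corner i := 4 ^ q.1 * (q.2 i + ((α i).toNat : ℤ) / 3)
  side := 4 ^ q.1
  side_pos := by positivity

theorem mem_gridCube_iff {α : Fin d → Bool} {q : ℤ × (Fin d → ℤ)} {x : Fin d → ℝ} :
    x ∈ (gridCube α q).toSet ↔ ∀ i, ⌊x i / 4 ^ q.1 - ((α i).toNat : ℤ) / 3⌋ = q.2 i := by
  have h4 : (0 : ℝ) < 4 ^ q.1 := by positivity
  simp only [Cube.toSet, gridCube, Set.mem_pi, Set.mem_univ, true_imp_iff, Set.mem_Ico,
    Int.floor_eq_iff]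
  refine forall_congr' fun i => ?_
  have h1 : 4 ^ q.1 * ((q.2 i : ℝ) + ((α i).toNat : ℤ) / 3) + 4 ^ q.1 =
      4 ^ q.1 * ((q.2 i : ℝ) + ((α i).toNat : ℤ) / 3 + 1) := by ring
  rw [h1, ← le_div_iff₀' h4, ← div_lt_iff₀' h4]
  constructor <;> rintro ⟨h2, h3⟩ <;> constructor <;> linarith

/-- The reason for base 4: a shift by a third of the side 4^(l+1) is 4/3 = 1 + 1/3 in units of 4^l,
an integer away from the shift at scale l. So the index of a parent is a function of the index of
its child, and each grid is nested. -/
theorem floor_grid_succ (t : ℝ) (l e : ℤ) :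
    ⌊t / 4 ^ (l + 1) - (e : ℝ) / 3⌋ = (⌊t / 4 ^ l - (e : ℝ) / 3⌋ - e) / 4 := by
  have h1 : t / 4 ^ (l + 1) - (e : ℝ) / 3 = (t / 4 ^ l - (e : ℝ) / 3 - e) / (4 : ℕ) := by
    rw [zpow_add_one₀ (by norm_num)]; push_cast; field_simp; ring
  rw [h1, Int.floor_div_natCast, Int.floor_sub_intCast]
  rfl

theorem floor_grid_eq_of_le {t t' : ℝ} {k l e : ℤ} (hkl : k ≤ l)
    (h : ⌊t / 4 ^ k - (e : ℝ) / 3⌋ = ⌊t' / 4 ^ k - (e : ℝ) / 3⌋) :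
    ⌊t / 4 ^ l - (e : ℝ) / 3⌋ = ⌊t' / 4 ^ l - (e : ℝ) / 3⌋ := by
  induction l, hkl using Int.leInduction with
  | base => exact h
  | succ l _ ih => rw [floor_grid_succ, floor_grid_succ, ih]

theorem isLaminar_gridCube (α : Fin d → Bool) : IsLaminar fun q => (gridCube α q).toSet := by
  have key : ∀ q r : ℤ × (Fin d → ℤ), q.1 ≤ r.1 →
      Disjoint (gridCube α q).toSet (gridCube α r).toSet ∨
        (gridCube α q).toSet ⊆ (gridCube α r).toSet := by
    intro q r hqr
    refine or_iff_not_imp_left.2 fun hd => ?_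
    obtain ⟨x, hxq, hxr⟩ := Set.not_disjoint_iff.1 hd
    intro y hy
    rw [mem_gridCube_iff] at hxq hxr hy ⊢
    intro i
    rw [← hxr i]
    exact floor_grid_eq_of_le hqr ((hy i).trans (hxq i).symm)
  intro q r
  rcases le_total q.1 r.1 with h | h
  · exact (key q r h).imp_right Or.inl
  · exact (key r q h).imp (fun h => h.symm) Or.inr

theorem exists_gridCube (Q : Cube d) : ∃ (α : Fin d → Bool) (q : ℤ × (Fin d → ℤ)),
    Q.toSet ⊆ (gridCube α q).toSet ∧
      volume (gridCube α q).toSet ≤ 12 ^ d * volume Q.toSet := by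
  have hQ := Q.side_pos
  -- The grid side L = 4^(n+1) satisfies 3·side ≤ L < 12·side. An interval of length at most L/3
  -- that crosses the end of its unshifted grid interval lies in one shifted by L/3. The choice is
  -- made coordinate by coordinate, hence 2^d grids.
  obtain ⟨n, hn1, hn2⟩ := exists_mem_Ioc_zpow (show 0 < 3 * Q.side by positivity)
    (show (1 : ℝ) < 4 by norm_num)
  set L : ℝ := 4 ^ (n + 1) with hL
  have hL0 : 0 < L := by positivity
  have hL12 : L ≤ 12 * Q.side := by
    rw [hL, zpow_add_one₀ (by norm_num)]; linarith
  have key : ∀ a : ℝ, ∃ (b : Bool) (m : ℤ), L * (m + (b.toNat : ℤ) / 3) ≤ a ∧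
      a + Q.side ≤ L * (m + (b.toNat : ℤ) / 3) + L := by
    intro a
    have h1 := Int.floor_le (a / L)
    have h2 := Int.lt_floor_add_one (a / L)
    rw [le_div_iff₀' hL0] at h1
    rw [div_lt_iff₀' hL0] at h2
    by_cases h : a + Q.side ≤ L * (⌊a / L⌋ + 1)
    · exact ⟨false, ⌊a / L⌋, by simpa using h1, by simpa using by linarith⟩
    · refine ⟨true, ⌊a / L⌋, ?_, ?_⟩ <;> simp <;> linarith
  choose b m hb1 hb2 using key
  refine ⟨fun i => b (Q.corner i), (n + 1, fun i => m (Q.corner i)), ?_, ?_⟩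
  · intro x hx i _
    have h3 := hx i (Set.mem_univ i)
    simp only [gridCube, Set.mem_Ico] at h3 ⊢
    constructor
    · exact (hb1 _).trans h3.1
    · exact h3.2.trans_le (hb2 _)
  · rw [Cube.volume_toSet, Cube.volume_toSet, ← mul_pow]
    gcongr
    change ENNReal.ofReal L ≤ _
    rw [← ENNReal.ofReal_ofNat 12, ← ENNReal.ofReal_mul (by norm_num)]
    exact ENNReal.ofReal_le_ofReal hL12

/-- The maximal operator over finitely many cubes of a grid. -/
noncomputable def gridMax (α : Fin d → Bool) (s : Finset (ℤ × (Fin d → ℤ)))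
    (u : (Fin d → ℝ) → ℝ≥0∞) : (Fin d → ℝ) → ℝ≥0∞ :=
  finMax volume (fun q => (gridCube α q).toSet) (fun q => volume (gridCube α q).toSet) s u

theorem measurable_gridMax (α : Fin d → Bool) (s : Finset (ℤ × (Fin d → ℤ)))
    (u : (Fin d → ℝ) → ℝ≥0∞) : Measurable (gridMax α s u) :=
  measurable_finMax _ (fun _ => Cube.measurableSet_toSet _) _ _ _

theorem gridMax_mono (α : Fin d → Bool) (u : (Fin d → ℝ) → ℝ≥0∞) :
    Monotone fun s => gridMax α s u :=
  fun _ _ hst _ => biSup_mono fun _ hi => hst hi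

theorem maxFn_le_iSup_gridMax (u : (Fin d → ℝ) → ℝ≥0∞) (x : Fin d → ℝ) :
    maxFn u x ≤ 12 ^ d * ⨆ (α : Fin d → Bool), ⨆ s, gridMax α s u x := by
  refine maxFn_le fun Q hx => ?_
  obtain ⟨α, q, hsub, hvol⟩ := exists_gridCube Q
  refine (Cube.lavg_le_mul_lavg hsub hvol u).trans ?_
  gcongr
  refine le_trans ?_ (le_iSup _ α)
  refine le_trans ?_ (le_iSup _ {q})
  rw [gridMax, finMax]
  simp only [Finset.mem_singleton, iSup_iSup_eq_left]
  rw [Set.indicator_of_mem (hsub hx)]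
  rfl

/-- Weighted integrals of powers of `M u` are controlled by the integrals over finite parts
of the grids. -/
theorem lintegral_maxFn_mul_le (u f : (Fin d → ℝ) → ℝ≥0∞) (hf : Measurable f) {c : ℝ≥0∞}
    {p : ℝ} (hp : 0 < p) (h : ∀ α s, ∫⁻ x, gridMax α s u x ^ p * f x ≤ c) :
    ∫⁻ x, maxFn u x ^ p * f x ≤ (12 ^ d) ^ p * (2 ^ d * c) := by
  have h1 : ∀ α : Fin d → Bool, ∫⁻ x, (⨆ s, gridMax α s u x) ^ p * f x ≤ c := by
    intro α
    have h2 : ∀ x, (⨆ s, gridMax α s u x) ^ p * f x = ⨆ s, gridMax α s u x ^ p * f x := by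
      intro x
      have h := (ENNReal.orderIsoRpow p hp).map_iSup fun s => gridMax α s u x
      simp only [ENNReal.orderIsoRpow_apply] at h
      rw [h, ENNReal.iSup_mul]
    simp_rw [h2]
    rw [lintegral_iSup_directed fun s => (show Measurable fun x => gridMax α s u x ^ p * f x from
      ((measurable_gridMax α s u).pow_const p).mul hf).aemeasurable]
    · exact iSup_le (h α)
    · refine Monotone.directed_le fun s t hst x => ?_
      have := gridMax_mono α u hst x
      dsimp only at this ⊢
      gcongr
  calc ∫⁻ x, maxFn u x ^ p * f x
      ≤ ∫⁻ x, (12 ^ d) ^ p * ∑ α : Fin d → Bool, (⨆ s, gridMax α s u x) ^ p * f x := by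
        refine lintegral_mono fun x => ?_
        have h3 : (⨆ α : Fin d → Bool, ⨆ s, gridMax α s u x) ^ p ≤
            ∑ α : Fin d → Bool, (⨆ s, gridMax α s u x) ^ p := by
          have h := (ENNReal.orderIsoRpow p hp).map_iSup
            fun α : Fin d → Bool => ⨆ s, gridMax α s u x
          simp only [ENNReal.orderIsoRpow_apply] at h
          rw [h]
          exact iSup_le fun α => Finset.single_le_sum
            (f := fun α : Fin d → Bool => (⨆ s, gridMax α s u x) ^ p)
            (fun _ _ => zero_le) (Finset.mem_univ α)
        calc maxFn u x ^ p * f x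
            ≤ (12 ^ d * ⨆ (α : Fin d → Bool), ⨆ s, gridMax α s u x) ^ p * f x := by
              gcongr; exact maxFn_le_iSup_gridMax u x
          _ = (12 ^ d) ^ p * ((⨆ (α : Fin d → Bool), ⨆ s, gridMax α s u x) ^ p * f x) := by
              rw [ENNReal.mul_rpow_of_nonneg _ _ hp.le, mul_assoc]
          _ ≤ (12 ^ d) ^ p * ((∑ α : Fin d → Bool, (⨆ s, gridMax α s u x) ^ p) * f x) := by
              gcongr
          _ = _ := by rw [Finset.sum_mul]
    _ = (12 ^ d) ^ p * ∑ α : Fin d → Bool, ∫⁻ x, (⨆ s, gridMax α s u x) ^ p * f x := by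
        have hm : ∀ α : Fin d → Bool, Measurable fun x => (⨆ s, gridMax α s u x) ^ p * f x :=
          fun α => ((Measurable.iSup fun s => measurable_gridMax α s u).pow_const p).mul hf
        rw [lintegral_const_mul _ (Finset.measurable_sum _ fun α _ => hm α),
          lintegral_finsetSum _ fun α _ => hm α]
    _ ≤ (12 ^ d) ^ p * ∑ α : Fin d → Bool, c := by gcongr with α; exact h1 α
    _ = (12 ^ d) ^ p * (2 ^ d * c) := by simp

/-- The Fefferman–Stein inequality. -/
theorem lintegral_maxFn_rpow_mul_le {h k : (Fin d → ℝ) → ℝ≥0∞} (hh : Measurable h)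
    (hk : Measurable k) {p : ℝ} (hp : 1 < p) :
    ∫⁻ x, maxFn h x ^ p * k x ≤ (12 ^ d) ^ p * (2 ^ d *
      (ENNReal.ofReal (2 ^ p * (p / (p - 1))) * ∫⁻ x, h x ^ p * maxFn k x)) := by
  refine lintegral_maxFn_mul_le h k hk (by linarith) fun α s => ?_
  -- Here ν = k dx and u = Mk: the mass of k on a cube is its volume times the average of k, which
  -- is at most Mk at every point of the cube.
  have key := lintegral_finMax_rpow_le (μ := volume) (ν := volume.withDensity k)
    (A := fun q => (gridCube α q).toSet) (m := fun q => volume (gridCube α q).toSet)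
    (isLaminar_gridCube α) (fun _ => Cube.measurableSet_toSet _) (fun _ => Cube.volume_ne_zero _)
    (fun _ => Cube.volume_ne_top _) (fun _ => le_rfl) (u := maxFn k) (fun q => ?_) s hh
    (measurable_maxFn k) hp
  · change ∫⁻ x, gridMax α s h x ^ p ∂_ ≤ _ at key
    rw [lintegral_withDensity_eq_lintegral_mul _ hk
      ((measurable_gridMax α s h).pow_const p)] at key
    refine le_trans (le_of_eq ?_) key
    refine lintegral_congr fun x => ?_
    rw [Pi.mul_apply, mul_comm]
  · refine ae_of_all _ fun x hx => ?_
    rw [withDensity_apply _ (Cube.measurableSet_toSet _), ← Cube.volume_mul_lavg]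
    gcongr
    exact lavg_le_maxFn k hx

end Grids

/-! ### Hölder, absorption and weight-independent maximal bounds -/

section WeightedInequalities

theorem ENNReal.rpow_le_self_of_one_le {x : ℝ≥0∞} (hx : 1 ≤ x) {a : ℝ} (ha : a ≤ 1) :
    x ^ a ≤ x :=
  (ENNReal.rpow_le_rpow_of_exponent_le hx ha).trans_eq (ENNReal.rpow_one x)

theorem ENNReal.self_le_rpow_of_one_le {x : ℝ≥0∞} (hx : 1 ≤ x) {a : ℝ} (ha : 1 ≤ a) :
    x ≤ x ^ a :=
  (ENNReal.rpow_one x).symm.trans_le (ENNReal.rpow_le_rpow_of_exponent_le hx ha)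

/-- Absorption: divide by J^(1/q), which is legitimate only because J is known to be finite. -/
theorem ENNReal.rpow_le_of_le_mul_rpow {p q : ℝ} (hpq : p.HolderConjugate q) {J c : ℝ≥0∞}
    (hJ : J ≠ ∞) (h : J ≤ c * J ^ (1 / q)) : J ≤ c ^ p := by
  by_cases hJ0 : J = 0
  · rw [hJ0]; exact zero_le
  have hq0 : J ^ (1 / q) ≠ 0 := by simp [ENNReal.rpow_eq_zero_iff, hJ0, hJ]
  have hqt : J ^ (1 / q) ≠ ∞ := ENNReal.rpow_ne_top_of_nonneg (by simpa using hpq.symm.nonneg) hJ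
  have h1 : J = J ^ (1 / p) * J ^ (1 / q) := by
    rw [← ENNReal.rpow_add _ _ hJ0 hJ, one_div, one_div, hpq.inv_add_inv_eq_one,
      ENNReal.rpow_one]
  have h2 : J ^ (1 / p) ≤ c := by
    refine (ENNReal.mul_le_mul_iff_left hq0 hqt).1 ?_
    rw [← h1]; exact h
  calc J = (J ^ (1 / p)) ^ p := by
        rw [← ENNReal.rpow_mul, one_div, inv_mul_cancel₀ hpq.ne_zero, ENNReal.rpow_one]
    _ ≤ c ^ p := ENNReal.rpow_le_rpow h2 hpq.nonneg

variable {Ω : Type*} [MeasurableSpace Ω]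

theorem lintegral_mul_mul_le_Lp_mul_Lq (μ : Measure Ω) {p q : ℝ} (hpq : p.HolderConjugate q)
    {f g w : Ω → ℝ≥0∞} (hf : Measurable f) (hg : Measurable g) (hw : Measurable w) :
    ∫⁻ x, f x * g x * w x ∂μ ≤
      (∫⁻ x, f x ^ p * w x ∂μ) ^ (1 / p) * (∫⁻ x, g x ^ q * w x ∂μ) ^ (1 / q) := by
  have h := ENNReal.lintegral_mul_le_Lp_mul_Lq (μ.withDensity w) hpq hf.aemeasurable
    hg.aemeasurable
  have e : ∀ u : Ω → ℝ≥0∞, Measurable u →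
      ∫⁻ x, u x ∂μ.withDensity w = ∫⁻ x, u x * w x ∂μ := fun u hu => by
    rw [lintegral_withDensity_eq_lintegral_mul _ hw hu]
    simp_rw [Pi.mul_apply, mul_comm]
  rw [e _ (hf.mul hg), e _ (hf.pow_const p), e _ (hg.pow_const q)] at h
  exact h

variable {d : ℕ}

/-- The weighted maximal operator of a grid is bounded on `L^p(w)` with a constant that does not
depend on the weight. -/
theorem lintegral_weighted_gridMax_rpow_le (α : Fin d → Bool) (s : Finset (ℤ × (Fin d → ℤ)))
    {w G : (Fin d → ℝ) → ℝ≥0∞} (hw : Measurable w) (hG : Measurable G)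
    (hw0 : ∀ Q : Cube d, ∫⁻ x in Q.toSet, w x ≠ 0) (hwt : ∀ Q : Cube d, ∫⁻ x in Q.toSet, w x ≠ ∞)
    {p : ℝ} (hp : 1 < p) :
    ∫⁻ x, finMax (volume.withDensity w) (fun q => (gridCube α q).toSet)
        (fun q => ∫⁻ x in (gridCube α q).toSet, w x) s G x ^ p * w x ≤
      ENNReal.ofReal (2 ^ p * (p / (p - 1))) * ∫⁻ x, G x ^ p * w x := by
  have e : ∀ q, volume.withDensity w (gridCube α q).toSet =
      ∫⁻ x in (gridCube α q).toSet, w x :=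
    fun q => withDensity_apply _ (Cube.measurableSet_toSet _)
  have e' : ∀ u : (Fin d → ℝ) → ℝ≥0∞, Measurable u →
      ∫⁻ x, u x ∂volume.withDensity w = ∫⁻ x, u x * w x := fun u hu => by
    rw [lintegral_withDensity_eq_lintegral_mul _ hw hu]
    simp_rw [Pi.mul_apply, mul_comm]
  -- Both measures are w dx and the normalization is the w-mass of the cube, so u = 1 is admissible
  -- and no property of w enters the constant.
  have key := lintegral_finMax_rpow_le (μ := volume.withDensity w) (ν := volume.withDensity w)
    (A := fun q => (gridCube α q).toSet) (m := fun q => ∫⁻ x in (gridCube α q).toSet, w x)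
    (isLaminar_gridCube α) (fun _ => Cube.measurableSet_toSet _) (fun _ => hw0 _)
    (fun _ => hwt _) (fun q => (e q).le) (u := fun _ => 1)
    (fun q => ae_of_all _ fun x _ => by rw [mul_one]; exact (e q).le) s hG measurable_const hp
  simp only [mul_one] at key
  rw [e' _ ((measurable_finMax _ (fun _ => Cube.measurableSet_toSet _) _ _ _).pow_const p),
    e' _ (hG.pow_const p)] at key
  exact key

end WeightedInequalities

/-! ### Classes of weights stable under the maximal operator -/

section MaximalClass

variable {d : ℕ}

/-- A class of weights that is preserved by the maximal operator up to the factor `B`, and that is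
uniformly locally integrable and locally nondegenerate. -/
structure IsMaximalClass (W : Set ((Fin d → ℝ) → ℝ≥0∞)) (B : ℝ≥0∞) : Prop where
  measurable : ∀ k ∈ W, Measurable k
  maxFn_le : ∀ k ∈ W, ∃ k' ∈ W, ∀ᵐ x, maxFn k x ≤ B * k' x
  lintegral_le : ∀ Q : Cube d, ∃ C : ℝ≥0∞, C ≠ ∞ ∧ ∀ k ∈ W, ∫⁻ x in Q.toSet, k x ≤ C
  exists_ge : ∀ Q : Cube d, ∃ k ∈ W, ∃ ε : ℝ≥0∞, ε ≠ 0 ∧ ε ≠ ∞ ∧ ∀ᵐ x, x ∈ Q.toSet → ε ≤ k x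

/-- The supremum of the norms of `L^p(k)`, `k ∈ W`. -/
noncomputable def supNorm {Ω : Type*} [MeasurableSpace Ω] (μ : Measure Ω)
    (W : Set (Ω → ℝ≥0∞)) (p : ℝ) (u : Ω → ℝ≥0∞) : ℝ≥0∞ :=
  ⨆ k ∈ W, (∫⁻ x, u x ^ p * k x ∂μ) ^ (1 / p)

section SupNorm

variable {Ω : Type*} [MeasurableSpace Ω] {μ : Measure Ω} {W : Set (Ω → ℝ≥0∞)} {p : ℝ}

theorem lintegral_rpow_le_supNorm (hp : 0 < p) (u : Ω → ℝ≥0∞) {k : Ω → ℝ≥0∞} (hk : k ∈ W) :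
    ∫⁻ x, u x ^ p * k x ∂μ ≤ supNorm μ W p u ^ p := by
  have h : (∫⁻ x, u x ^ p * k x ∂μ) ^ (1 / p) ≤ supNorm μ W p u :=
    le_iSup₂ (f := fun k (_ : k ∈ W) => (∫⁻ x, u x ^ p * k x ∂μ) ^ (1 / p)) k hk
  have := ENNReal.rpow_le_rpow h hp.le
  rwa [← ENNReal.rpow_mul, one_div, inv_mul_cancel₀ hp.ne', ENNReal.rpow_one] at this

theorem supNorm_le (hp : 0 < p) {u : Ω → ℝ≥0∞} {c : ℝ≥0∞}
    (h : ∀ k ∈ W, ∫⁻ x, u x ^ p * k x ∂μ ≤ c ^ p) : supNorm μ W p u ≤ c := by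
  refine iSup₂_le fun k hk => ?_
  have := ENNReal.rpow_le_rpow (h k hk) (show 0 ≤ 1 / p by positivity)
  rwa [← ENNReal.rpow_mul, one_div, mul_inv_cancel₀ hp.ne', ENNReal.rpow_one, ← one_div] at this

end SupNorm

variable {W : Set ((Fin d → ℝ) → ℝ≥0∞)} {B : ℝ≥0∞} {p : ℝ}

/-- If k ≥ ε on Q, then f ≤ 1 + ε⁻¹ f^p k there, because f ≤ f^p wherever f > 1. -/
theorem IsMaximalClass.lintegral_ne_top (hW : IsMaximalClass W B) (hp : 1 < p)
    {f : (Fin d → ℝ) → ℝ≥0∞} (hρ : supNorm volume W p f ≠ ∞) (Q : Cube d) :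
    ∫⁻ x in Q.toSet, f x ≠ ∞ := by
  have hp0 : 0 < p := by linarith
  obtain ⟨k, hk, ε, hε, hεt, hεk⟩ := hW.exists_ge Q
  have h2 : ∀ᵐ x ∂volume.restrict Q.toSet, f x ≤ 1 + ε⁻¹ * (f x ^ p * k x) := by
    rw [ae_restrict_iff' Q.measurableSet_toSet]
    filter_upwards [hεk] with x hx hxQ
    by_cases h1 : f x ≤ 1
    · exact h1.trans le_self_add
    · refine le_trans ?_ le_add_self
      calc f x = f x ^ (1 : ℝ) := (ENNReal.rpow_one _).symm
        _ ≤ f x ^ p := ENNReal.rpow_le_rpow_of_exponent_le (not_le.1 h1).le hp.le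
        _ = ε⁻¹ * (f x ^ p * ε) := by
            rw [mul_left_comm, ENNReal.inv_mul_cancel hε hεt, mul_one]
        _ ≤ _ := by gcongr; exact hx hxQ
  refine ((lintegral_mono_ae h2).trans_lt ?_).ne
  rw [lintegral_add_left measurable_const, setLIntegral_const, one_mul,
    lintegral_const_mul' _ _ (ENNReal.inv_ne_top.2 hε)]
  refine ENNReal.add_lt_top.2 ⟨Q.volume_ne_top.lt_top, ENNReal.mul_lt_top
    (ENNReal.inv_lt_top.2 (pos_iff_ne_zero.2 hε)) ?_⟩
  exact (setLIntegral_le_lintegral _ _).trans_lt ((lintegral_rpow_le_supNorm hp0 f hk).trans_lt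
    (ENNReal.rpow_lt_top_of_nonneg hp0.le hρ))

/-- The Rubio de Francia iteration. -/
theorem IsMaximalClass.exists_majorant (hW : IsMaximalClass W B) (hp : 0 < p)
    {k : (Fin d → ℝ) → ℝ≥0∞} (hk : k ∈ W) :
    ∃ w : (Fin d → ℝ) → ℝ≥0∞, Measurable w ∧ (∀ x, k x ≤ w x) ∧
      (∀ᵐ x, maxFn w x ≤ 2 * B * w x) ∧ (∀ Q : Cube d, ∫⁻ x in Q.toSet, w x ≠ ∞) ∧
      ∀ u : (Fin d → ℝ) → ℝ≥0∞, Measurable u →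
        ∫⁻ x, u x ^ p * w x ≤ 2 * supNorm volume W p u ^ p := by
  choose! next hnW hnle using hW.maxFn_le
  set K : ℕ → (Fin d → ℝ) → ℝ≥0∞ := fun j => next^[j] k with hK
  have hKW : ∀ j, K j ∈ W := by
    intro j
    induction j with
    | zero => exact hk
    | succ j ih =>
      rw [hK]; simp only [Function.iterate_succ_apply']
      exact hnW _ ih
  have hKle : ∀ᵐ x, ∀ j, maxFn (K j) x ≤ B * K (j + 1) x := by
    refine ae_all_iff.2 fun j => ?_
    rw [hK]; simp only [Function.iterate_succ_apply']
    exact hnle _ (hKW j)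
  have hKm : ∀ j, Measurable (K j) := fun j => hW.measurable _ (hKW j)
  have hKm' : ∀ j, Measurable fun x => (2⁻¹ : ℝ≥0∞) ^ j * K j x := fun j => (hKm j).const_mul _
  have htsum : ∀ {c : ℝ≥0∞} {a : ℕ → ℝ≥0∞}, (∀ j, a j ≤ c) → ∑' j, 2⁻¹ ^ j * a j ≤ 2 * c := by
    intro c a h
    calc ∑' j, 2⁻¹ ^ j * a j ≤ ∑' j, 2⁻¹ ^ j * c := by gcongr with j; exact h j
      _ = 2 * c := by rw [ENNReal.tsum_mul_right, ENNReal.tsum_geometric_two]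
  -- With M K_j ≤ B K_{j+1}, applying M shifts the geometric series by one index at the cost of 2B.
  -- The sum need not belong to W: only its pairings with u^p are used, and these add up with total
  -- mass 2. Convergence in X is therefore never needed.
  refine ⟨fun x => ∑' j, 2⁻¹ ^ j * K j x, Measurable.tsum hKm', fun x => ?_, ?_, fun Q => ?_,
    fun u hu => ?_⟩
  · refine le_trans ?_ (ENNReal.le_tsum 0)
    simp [hK]
  · filter_upwards [hKle] with x hx
    refine (maxFn_tsum_le hKm' x).trans ?_
    calc ∑' j, maxFn (fun y => 2⁻¹ ^ j * K j y) x
        ≤ ∑' j, 2 * B * (2⁻¹ ^ (j + 1) * K (j + 1) x) := by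
          refine ENNReal.tsum_le_tsum fun j => (maxFn_const_mul_le (hKm j) _ x).trans ?_
          calc (2⁻¹ : ℝ≥0∞) ^ j * maxFn (K j) x ≤ 2⁻¹ ^ j * (B * K (j + 1) x) := by
                gcongr; exact hx j
            _ = (2 * 2⁻¹) * 2⁻¹ ^ j * (B * K (j + 1) x) := by
                rw [ENNReal.mul_inv_cancel (by norm_num) (by norm_num), one_mul]
            _ = _ := by ring
      _ = 2 * B * ∑' j, 2⁻¹ ^ (j + 1) * K (j + 1) x := ENNReal.tsum_mul_left
      _ ≤ _ := by
          gcongr 2 * B * ?_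
          exact ENNReal.tsum_comp_le_tsum_of_injective Nat.succ_injective
            (fun j => 2⁻¹ ^ j * K j x)
  · obtain ⟨C, hC, hCk⟩ := hW.lintegral_le Q
    rw [lintegral_tsum fun j => (hKm' j).aemeasurable]
    simp_rw [lintegral_const_mul _ (hKm _)]
    exact ((htsum fun j => hCk _ (hKW j)).trans_lt (ENNReal.mul_lt_top (by norm_num) hC.lt_top)).ne
  · simp_rw [← ENNReal.tsum_mul_left]
    rw [lintegral_tsum fun j => ((hu.pow_const p).fun_mul (hKm' j)).aemeasurable]
    have : ∀ j, ∫⁻ x, u x ^ p * (2⁻¹ ^ j * K j x) = 2⁻¹ ^ j * ∫⁻ x, u x ^ p * K j x := by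
      intro j
      rw [← lintegral_const_mul _ ((hu.pow_const p).fun_mul (hKm j))]
      exact lintegral_congr fun x => mul_left_comm _ _ _
    simp_rw [this]
    exact htsum fun j => lintegral_rpow_le_supNorm hp u (hKW j)

/-- If w vanished a.e. on Q, some point would have Mw ≤ A w = 0. All averages over cubes through
that point would be zero, and such cubes exhaust the space. -/
theorem lintegral_ne_zero_of_maxFn_le {w : (Fin d → ℝ) → ℝ≥0∞} (hw : Measurable w) {A : ℝ≥0∞}
    (hA : ∀ᵐ x, maxFn w x ≤ A * w x) (hne : ¬ ∀ᵐ x, w x = 0) (Q : Cube d) :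
    ∫⁻ x in Q.toSet, w x ≠ 0 := by
  intro h0
  rw [lintegral_eq_zero_iff hw, EventuallyEq, ae_restrict_iff' Q.measurableSet_toSet] at h0
  have h1 : ∃ x ∈ Q.toSet, maxFn w x ≤ A * w x ∧ w x = 0 := by
    by_contra! hcon
    refine Q.volume_ne_zero (measure_eq_zero_iff_ae_notMem.2 ?_)
    filter_upwards [hA, h0] with x hx hx0 hxQ
    exact hcon x hxQ hx (hx0 hxQ)
  obtain ⟨x, -, hx, hx0⟩ := h1
  rw [hx0, mul_zero, nonpos_iff_eq_zero] at hx
  obtain ⟨m, hm⟩ := Set.mem_iUnion.1 (Cube.iUnion_box d ▸ Set.mem_univ x)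
  have h2 : ∀ n, ∀ᵐ y, y ∈ (Cube.box d n).toSet → w y = 0 := by
    intro n
    have h3 : ∫⁻ y in (Cube.box d (max n m)).toSet, w y = 0 := by
      rw [← Cube.volume_mul_lavg]
      have := lavg_le_maxFn w (Cube.box_mono d (le_max_right n m) hm)
      rw [hx, nonpos_iff_eq_zero] at this
      rw [this, mul_zero]
    rw [lintegral_eq_zero_iff hw, EventuallyEq, ae_restrict_iff' (Cube.measurableSet_toSet _)] at h3
    filter_upwards [h3] with y hy hyn
    exact hy (Cube.box_mono d (le_max_left n m) hyn)
  refine hne ?_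
  filter_upwards [ae_all_iff.2 h2] with y hy
  obtain ⟨n, hn⟩ := Set.mem_iUnion.1 (Cube.iUnion_box d ▸ Set.mem_univ y)
  exact hy n hn

/-- The adjoint of a linearized grid maximal operator is bounded in the supremum norm of a
maximal class. -/
theorem IsMaximalClass.supNorm_adjoint_le (hW : IsMaximalClass W B) (hp : 1 < p)
    (α : Fin d → Bool) (s : Finset (ℤ × (Fin d → ℤ))) {F : ℤ × (Fin d → ℤ) → Set (Fin d → ℝ)}
    (hFm : ∀ q, MeasurableSet (F q)) (hFA : ∀ q, F q ⊆ (gridCube α q).toSet)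
    (hFd : (s : Set (ℤ × (Fin d → ℤ))).PairwiseDisjoint F) {f : (Fin d → ℝ) → ℝ≥0∞}
    (hf : Measurable f) (hρ : supNorm volume W p f ≠ ∞) :
    supNorm volume W p (fun x => ∑ q ∈ s, (gridCube α q).toSet.indicator
      (fun _ => (volume (gridCube α q).toSet)⁻¹ * ∫⁻ y in F q, f y) x) ≤
      8 * ENNReal.ofReal p * B * supNorm volume W p f := by
  have hp0 : 0 < p := by linarith
  set r := p.conjExponent with hr
  have hpr : p.HolderConjugate r := Real.HolderConjugate.conjExponent hp
  set A : ℤ × (Fin d → ℤ) → Set (Fin d → ℝ) := fun q => (gridCube α q).toSet with hA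
  have hAm : ∀ q, MeasurableSet (A q) := fun _ => Cube.measurableSet_toSet _
  set c : ℤ × (Fin d → ℤ) → ℝ≥0∞ := fun q => (volume (A q))⁻¹ * ∫⁻ y in F q, f y with hc
  set φ : (Fin d → ℝ) → ℝ≥0∞ := fun x => ∑ q ∈ s, (A q).indicator (fun _ => c q) x with hφ
  have hφm : Measurable φ :=
    Finset.measurable_sum _ fun q _ => measurable_const.indicator (hAm q)
  have hct : ∀ q, c q ≠ ∞ := fun q => ENNReal.mul_ne_top
    (ENNReal.inv_ne_top.2 (Cube.volume_ne_zero _))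
    ((lintegral_mono_set (hFA q)).trans_lt (hW.lintegral_ne_top hp hρ _).lt_top).ne
  have hexp : ∀ g : (Fin d → ℝ) → ℝ≥0∞, Measurable g →
      ∫⁻ x, φ x * g x = ∑ q ∈ s, c q * ∫⁻ x in A q, g x := by
    intro g hg
    simp_rw [hφ, Finset.sum_mul]
    rw [lintegral_finsetSum _ fun q _ => (measurable_const.indicator (hAm q)).fun_mul hg]
    refine Finset.sum_congr rfl fun q _ => ?_
    rw [← lintegral_const_mul _ hg, ← lintegral_indicator (hAm q)]
    refine lintegral_congr fun x => ?_
    by_cases hx : x ∈ A q <;> simp [hx]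
  refine supNorm_le hp0 fun k hk => ?_
  -- From here on the weight k is replaced by a majorant with Mw ≤ 2Bw.
  obtain ⟨w, hwm, hkw, hMw, hwt, hwρ⟩ := hW.exists_majorant hp0 hk
  refine (show ∫⁻ x, φ x ^ p * k x ≤ ∫⁻ x, φ x ^ p * w x by gcongr with x; exact hkw x).trans ?_
  by_cases hw0 : ∀ᵐ x, w x = 0
  · refine le_trans (le_of_eq ?_) zero_le
    rw [lintegral_eq_zero_iff ((hφm.pow_const p).fun_mul hwm)]
    filter_upwards [hw0] with x hx
    simp [hx]
  have hwQ := lintegral_ne_zero_of_maxFn_le hwm hMw hw0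
  have hsplit : ∀ x, φ x ^ p * w x = φ x * (φ x ^ (p - 1) * w x) := by
    intro x
    rw [← mul_assoc]
    congr 1
    conv_lhs => rw [show p = 1 + (p - 1) by ring,
      ENNReal.rpow_add_of_nonneg _ _ zero_le_one (by linarith), ENNReal.rpow_one]
  set G : (Fin d → ℝ) → ℝ≥0∞ := fun x => φ x ^ (p - 1) with hG
  have hGm : Measurable G := hφm.pow_const _
  -- Finiteness is required for the absorption at the end. It holds because s is finite, so φ is
  -- bounded by a finite sum of finite coefficients, and w is locally integrable.
  have hJt : ∫⁻ x, φ x ^ p * w x ≠ ∞ := by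
    have h1 : ∀ x, φ x ≤ ∑ q ∈ s, c q := fun x =>
      Finset.sum_le_sum fun q _ => Set.indicator_le_self' (fun _ _ => zero_le) x
    have h2 : ∫⁻ x, φ x ^ p * w x ≤ (∑ q ∈ s, c q) ^ (p - 1) * ∫⁻ x, φ x * w x := by
      rw [← lintegral_const_mul _ (hφm.fun_mul hwm)]
      refine lintegral_mono fun x => ?_
      rw [hsplit, mul_left_comm]
      gcongr
      exact h1 x
    refine (h2.trans_lt (ENNReal.mul_lt_top (ENNReal.rpow_lt_top_of_nonneg (by linarith) ?_) ?_)).ne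
    · exact ENNReal.sum_ne_top.2 fun q _ => hct q
    · rw [hexp w hwm]
      exact ENNReal.sum_lt_top.2 fun q _ => ENNReal.mul_lt_top (hct q).lt_top (hwt _).lt_top
  set N := finMax (volume.withDensity w) A (fun q => ∫⁻ x in A q, w x) s G with hN
  have hNm : Measurable N := measurable_finMax _ hAm _ _ _
  -- The integral of G w over A q, divided by the volume, is the average of w times the w-average of
  -- G. On F q ⊆ A q these are at most 2Bw and N respectively.
  have hterm : ∀ q ∈ s, c q * ∫⁻ x in A q, G x * w x ≤
      ∫⁻ x in F q, 2 * B * (f x * N x * w x) := by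
    intro q hq
    have h1 : ∫⁻ x in A q, G x * w x =
        (∫⁻ x in A q, w x) * ((∫⁻ x in A q, w x)⁻¹ * ∫⁻ x in A q, G x ∂volume.withDensity w) := by
      rw [← mul_assoc, ENNReal.mul_inv_cancel (hwQ _) (hwt _), one_mul,
        restrict_withDensity (hAm q), lintegral_withDensity_eq_lintegral_mul _ hwm hGm]
      simp_rw [Pi.mul_apply, mul_comm]
    set a := (∫⁻ x in A q, w x)⁻¹ * ∫⁻ x in A q, G x ∂volume.withDensity w with ha
    calc c q * ∫⁻ x in A q, G x * w x
        = (∫⁻ y in F q, f y) * ((gridCube α q).lavg w * a) := by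
          rw [h1, hc, Cube.lavg]; ring
      _ = ∫⁻ x in F q, f x * ((gridCube α q).lavg w * a) := (lintegral_mul_const _ hf).symm
      _ ≤ ∫⁻ x in F q, 2 * B * (f x * N x * w x) := by
          refine lintegral_mono_ae ((ae_restrict_iff' (hFm q)).2 ?_)
          filter_upwards [hMw] with x hx hxF
          have h2 : a ≤ N x := by
            have := le_iSup₂ (f := fun i (_ : i ∈ s) => (A i).indicator (fun _ =>
              (∫⁻ x in A i, w x)⁻¹ * ∫⁻ y in A i, G y ∂volume.withDensity w) x) q hq
            rwa [Set.indicator_of_mem (hFA q hxF)] at this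
          calc f x * ((gridCube α q).lavg w * a) ≤ f x * ((2 * B * w x) * N x) := by
                gcongr
                exact (lavg_le_maxFn w (hFA q hxF)).trans hx
            _ = _ := by ring
  have hmain : ∫⁻ x, φ x ^ p * w x ≤ 2 * B * ∫⁻ x, f x * N x * w x := by
    simp_rw [hsplit]
    change ∫⁻ x, φ x * (G x * w x) ≤ _
    rw [hexp _ (hGm.fun_mul hwm), ← lintegral_const_mul _ ((hf.fun_mul hNm).fun_mul hwm)]
    calc ∑ q ∈ s, c q * ∫⁻ x in A q, G x * w x
        ≤ ∑ q ∈ s, ∫⁻ x in F q, 2 * B * (f x * N x * w x) := Finset.sum_le_sum hterm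
      _ = ∫⁻ x in ⋃ q ∈ s, F q, 2 * B * (f x * N x * w x) :=
          (lintegral_biUnion_finset hFd (fun q _ => hFm q) _).symm
      _ ≤ _ := setLIntegral_le_lintegral _ _
  have hGr : ∫⁻ x, G x ^ r * w x = ∫⁻ x, φ x ^ p * w x := by
    refine lintegral_congr fun x => ?_
    rw [hG]
    simp only
    rw [← ENNReal.rpow_mul, hpr.sub_one_mul_conj]
  have hNr : ∫⁻ x, N x ^ r * w x ≤ ENNReal.ofReal (2 ^ r * p) * ∫⁻ x, φ x ^ p * w x := by
    have := lintegral_weighted_gridMax_rpow_le α s hwm hGm hwQ hwt hpr.symm.lt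
    rwa [hGr, show r / (r - 1) = p from hpr.symm.conjugate_eq.symm] at this
  have h1r : 0 ≤ 1 / r := by simpa using hpr.symm.nonneg
  -- The constant 8pB is 2B · 2 · 2p: from Mw ≤ 2Bw, from the majorant via 2^(1/p) ≤ 2, and from the
  -- weighted maximal bound via (2^r p)^(1/r) ≤ 2p.
  refine ENNReal.rpow_le_of_le_mul_rpow hpr hJt ?_
  calc ∫⁻ x, φ x ^ p * w x ≤ 2 * B * ∫⁻ x, f x * N x * w x := hmain
    _ ≤ 2 * B * ((∫⁻ x, f x ^ p * w x) ^ (1 / p) * (∫⁻ x, N x ^ r * w x) ^ (1 / r)) := by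
        gcongr
        exact lintegral_mul_mul_le_Lp_mul_Lq volume hpr hf hNm hwm
    _ ≤ 2 * B * ((2 * supNorm volume W p f ^ p) ^ (1 / p) *
          (ENNReal.ofReal (2 ^ r * p) * ∫⁻ x, φ x ^ p * w x) ^ (1 / r)) := by
        gcongr
        exact hwρ f hf
    _ ≤ 2 * B * ((2 * supNorm volume W p f) *
          (2 * ENNReal.ofReal p * (∫⁻ x, φ x ^ p * w x) ^ (1 / r))) := by
        gcongr
        · rw [ENNReal.mul_rpow_of_nonneg _ _ (by positivity), ← ENNReal.rpow_mul,
            mul_one_div_cancel hp0.ne', ENNReal.rpow_one]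
          gcongr
          refine ENNReal.rpow_le_self_of_one_le (by norm_num) ?_
          rw [div_le_one hp0]; exact hp.le
        · rw [ENNReal.mul_rpow_of_nonneg _ _ h1r, ENNReal.ofReal_mul (by positivity),
            ENNReal.mul_rpow_of_nonneg _ _ h1r, ← ENNReal.ofReal_rpow_of_pos (by norm_num),
            ← ENNReal.rpow_mul, mul_one_div_cancel hpr.symm.ne_zero, ENNReal.rpow_one,
            ENNReal.ofReal_ofNat]
          gcongr
          refine ENNReal.rpow_le_self_of_one_le (by simpa using hp.le) ?_
          rw [div_le_one hpr.symm.pos]; exact hpr.symm.lt.le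
    _ = 8 * ENNReal.ofReal p * B * supNorm volume W p f * (∫⁻ x, φ x ^ p * w x) ^ (1 / r) := by
        ring

/-- Fefferman–Stein puts Mk in place of k, and Mk ≤ B k' brings the weight back into the class. The
factor B^(1/p) is the p-th root of this single use of B. -/
theorem IsMaximalClass.supNorm_maxFn_le (hW : IsMaximalClass W B) (hp : 1 < p)
    {h : (Fin d → ℝ) → ℝ≥0∞} (hh : Measurable h) :
    supNorm volume W p (maxFn h) ≤
      12 ^ d * 2 ^ d * 2 * ENNReal.ofReal (p / (p - 1)) * B ^ (1 / p) * supNorm volume W p h := by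
  have hp0 : 0 < p := by linarith
  have hp1 : 1 ≤ p / (p - 1) := by rw [le_div_iff₀ (by linarith)]; linarith
  refine supNorm_le hp0 fun k hk => ?_
  obtain ⟨k', hk', hkk'⟩ := hW.maxFn_le k hk
  have hB : ∫⁻ x, h x ^ p * maxFn k x ≤ B * supNorm volume W p h ^ p := by
    calc ∫⁻ x, h x ^ p * maxFn k x ≤ ∫⁻ x, B * (h x ^ p * k' x) := by
          refine lintegral_mono_ae ?_
          filter_upwards [hkk'] with x hx
          rw [mul_left_comm]
          gcongr
      _ = B * ∫⁻ x, h x ^ p * k' x :=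
          lintegral_const_mul _ ((hh.pow_const p).fun_mul (hW.measurable _ hk'))
      _ ≤ _ := by gcongr; exact lintegral_rpow_le_supNorm hp0 h hk'
  refine (lintegral_maxFn_rpow_mul_le hh (hW.measurable k hk) hp).trans ?_
  -- Factors at least 1 are raised to the power p, so that a clean p-th root can be taken.
  have h2d : (2 : ℝ≥0∞) ^ d ≤ (2 ^ d) ^ p :=
    ENNReal.self_le_rpow_of_one_le (one_le_pow₀ (by norm_num)) hp.le
  have hpp : ENNReal.ofReal (p / (p - 1)) ≤ ENNReal.ofReal (p / (p - 1)) ^ p :=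
    ENNReal.self_le_rpow_of_one_le (by simpa using hp1) hp.le
  have hBp : B = (B ^ (1 / p)) ^ p := by
    rw [← ENNReal.rpow_mul, one_div, inv_mul_cancel₀ hp0.ne', ENNReal.rpow_one]
  calc (12 ^ d) ^ p * (2 ^ d * (ENNReal.ofReal (2 ^ p * (p / (p - 1))) *
        ∫⁻ x, h x ^ p * maxFn k x))
      ≤ (12 ^ d) ^ p * ((2 ^ d) ^ p * (2 ^ p * ENNReal.ofReal (p / (p - 1)) ^ p *
        ((B ^ (1 / p)) ^ p * supNorm volume W p h ^ p))) := by
        rw [← hBp, ENNReal.ofReal_mul (by positivity), ← ENNReal.ofReal_rpow_of_pos (by norm_num),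
          ENNReal.ofReal_ofNat]
        gcongr
    _ = _ := by
        simp only [ENNReal.mul_rpow_of_nonneg _ _ hp0.le]
        ring

/-- The maximal function of g is linearized on each grid and transposed onto f, so that the
hypothesis on g is used only against the adjoint image φ, whose `supNorm` is controlled. -/
theorem IsMaximalClass.lintegral_maxFn_mul_le (hW : IsMaximalClass W B) (hp : 1 < p)
    {g : (Fin d → ℝ) → ℝ≥0∞} (hg : Measurable g) {D : ℝ≥0∞}
    (hD : ∀ f : (Fin d → ℝ) → ℝ≥0∞, Measurable f → supNorm volume W p f ≠ ∞ →
      ∫⁻ x, g x * f x ≤ D * supNorm volume W p f)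
    (hB : B ≠ ∞) {f : (Fin d → ℝ) → ℝ≥0∞} (hf : Measurable f) (hρ : supNorm volume W p f ≠ ∞) :
    ∫⁻ x, maxFn g x * f x ≤
      12 ^ d * 2 ^ d * 8 * ENNReal.ofReal p * B * D * supNorm volume W p f := by
  have key : ∀ α s, ∫⁻ x, gridMax α s g x ^ (1 : ℝ) * f x ≤
      D * (8 * ENNReal.ofReal p * B * supNorm volume W p f) := by
    intro α s
    set A : ℤ × (Fin d → ℤ) → Set (Fin d → ℝ) := fun q => (gridCube α q).toSet with hA
    have hAm : ∀ q, MeasurableSet (A q) := fun _ => Cube.measurableSet_toSet _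
    obtain ⟨F, hFm, hFA, hFd, hF⟩ := exists_disjoint_subsets_iSup_le_sum s A hAm
      fun q => (volume (A q))⁻¹ * ∫⁻ y in A q, g y
    have hadj := hW.supNorm_adjoint_le hp α s hFm hFA hFd hf hρ
    set φ : (Fin d → ℝ) → ℝ≥0∞ := fun x => ∑ q ∈ s, (A q).indicator
      (fun _ => (volume (A q))⁻¹ * ∫⁻ y in F q, f y) x with hφ
    have hφm : Measurable φ :=
      Finset.measurable_sum _ fun q _ => measurable_const.indicator (hAm q)
    have hsum : ∀ (c : ℤ × (Fin d → ℤ) → ℝ≥0∞) (E : ℤ × (Fin d → ℤ) → Set (Fin d → ℝ))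
        (_ : ∀ q, MeasurableSet (E q)) (v : (Fin d → ℝ) → ℝ≥0∞) (_ : Measurable v),
        ∫⁻ x, (∑ q ∈ s, (E q).indicator (fun _ => c q) x) * v x =
          ∑ q ∈ s, c q * ∫⁻ x in E q, v x := by
      intro c E hE v hv
      simp_rw [Finset.sum_mul]
      rw [lintegral_finsetSum _ fun q _ => (measurable_const.indicator (hE q)).fun_mul hv]
      refine Finset.sum_congr rfl fun q _ => ?_
      rw [← lintegral_const_mul _ hv, ← lintegral_indicator (hE q)]
      refine lintegral_congr fun x => ?_
      by_cases hx : x ∈ E q <;> simp [hx]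
    calc ∫⁻ x, gridMax α s g x ^ (1 : ℝ) * f x
        ≤ ∫⁻ x, (∑ q ∈ s, (F q).indicator
          (fun _ => (volume (A q))⁻¹ * ∫⁻ y in A q, g y) x) * f x := by
          gcongr with x
          rw [ENNReal.rpow_one]
          exact hF x
      _ = ∫⁻ x, φ x * g x := by
          rw [hsum _ F hFm f hf, hsum _ A hAm g hg]
          refine Finset.sum_congr rfl fun q _ => ?_
          ring
      _ = ∫⁻ x, g x * φ x := by simp_rw [mul_comm]
      _ ≤ D * supNorm volume W p φ := by
          refine hD φ hφm (hadj.trans_lt ?_).ne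
          finiteness
      _ ≤ _ := by gcongr
  have := _root_.lintegral_maxFn_mul_le g f hf zero_lt_one key
  simp only [ENNReal.rpow_one] at this
  refine this.trans_eq ?_
  ring

/-! ### Sparse operators and converse duality -/

/-- The sum of `⟨f⟩_Q 1_Q` over a collection of cubes. -/
noncomputable def cubeSum (S : Set (Cube d)) (f : (Fin d → ℝ) → ℝ≥0∞) (x : Fin d → ℝ) : ℝ≥0∞ :=
  ∑' Q : S, (Q : Cube d).toSet.indicator (fun _ => (Q : Cube d).lavg f) x

/-- The sets E_Q are disjoint with positive measure, and Lebesgue measure is σ-finite. -/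
theorem Cube.IsSparse.countable {S : Set (Cube d)} (hS : Cube.IsSparse S) : S.Countable := by
  obtain ⟨E, hEd, hE⟩ := hS
  have h := Measure.countable_meas_pos_of_disjoint_iUnion (μ := volume)
    (As := fun Q : S => E Q) (fun Q => (hE Q Q.2).1)
    (fun Q R hQR => hEd Q.2 R.2 fun h => hQR (Subtype.ext h))
  have h2 : {Q : S | 0 < volume (E Q)} = Set.univ := by
    refine Set.eq_univ_of_forall fun Q => ?_
    refine lt_of_lt_of_le ?_ (hE Q Q.2).2.2
    exact ENNReal.mul_pos (by simp) (Cube.volume_ne_zero _)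
  rw [h2, Set.countable_univ_iff] at h
  exact Set.countable_coe_iff.1 h

theorem Cube.IsSparse.measurable_cubeSum {S : Set (Cube d)} (hS : Cube.IsSparse S)
    (f : (Fin d → ℝ) → ℝ≥0∞) : Measurable (cubeSum S f) := by
  have := hS.countable.to_subtype
  exact Measurable.tsum fun Q => measurable_const.indicator (Cube.measurableSet_toSet _)

/-- Each term is |Q| times two averages. Since |Q| ≤ 2|E_Q| and both maximal functions dominate
these averages on E_Q, the terms are integrals over disjoint sets. -/
theorem Cube.IsSparse.lintegral_cubeSum_mul_le {S : Set (Cube d)} (hS : Cube.IsSparse S)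
    (f : (Fin d → ℝ) → ℝ≥0∞) {g : (Fin d → ℝ) → ℝ≥0∞} (hg : Measurable g) :
    ∫⁻ x, cubeSum S f x * g x ≤ 2 * ∫⁻ x, maxFn g x * maxFn f x := by
  have := hS.countable.to_subtype
  obtain ⟨E, hEd, hE⟩ := hS
  have hvol : ∀ Q : S, volume (Q : Cube d).toSet ≤ 2 * volume (E Q) := by
    intro Q
    have h := (hE Q Q.2).2.2
    calc volume (Q : Cube d).toSet = 2 * (ENNReal.ofReal (1 / 2) * volume (Q : Cube d).toSet) := by
          rw [← mul_assoc, ← ENNReal.ofReal_ofNat 2, ← ENNReal.ofReal_mul (by norm_num)]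
          norm_num
      _ ≤ _ := by gcongr
  calc ∫⁻ x, cubeSum S f x * g x
      = ∑' Q : S, (Q : Cube d).lavg f * ∫⁻ x in (Q : Cube d).toSet, g x := by
        simp_rw [cubeSum, ← ENNReal.tsum_mul_right]
        rw [lintegral_tsum fun Q => ((measurable_const.indicator
          (Cube.measurableSet_toSet _)).fun_mul hg).aemeasurable]
        refine tsum_congr fun Q => ?_
        rw [← lintegral_const_mul _ hg, ← lintegral_indicator (Cube.measurableSet_toSet _)]
        refine lintegral_congr fun x => ?_
        by_cases hx : x ∈ (Q : Cube d).toSet <;> simp [hx]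
    _ ≤ ∑' Q : S, 2 * ∫⁻ x in E Q, maxFn g x * maxFn f x := by
        refine ENNReal.tsum_le_tsum fun Q => ?_
        rw [← Cube.volume_mul_lavg]
        calc (Q : Cube d).lavg f * (volume (Q : Cube d).toSet * (Q : Cube d).lavg g)
            ≤ (Q : Cube d).lavg f * ((2 * volume (E Q)) * (Q : Cube d).lavg g) := by
              gcongr; exact hvol Q
          _ = 2 * ∫⁻ x in E Q, (Q : Cube d).lavg g * (Q : Cube d).lavg f := by
              rw [setLIntegral_const]; ring
          _ ≤ _ := by
              gcongr 2 * ?_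
              refine setLIntegral_mono' (hE Q Q.2).1 fun x hx => ?_
              gcongr
              · exact lavg_le_maxFn g ((hE Q Q.2).2.1 hx)
              · exact lavg_le_maxFn f ((hE Q Q.2).2.1 hx)
    _ = 2 * ∫⁻ x in ⋃ Q : S, E Q, maxFn g x * maxFn f x := by
        rw [ENNReal.tsum_mul_left, lintegral_iUnion (fun Q : S => (hE Q Q.2).1)
          (fun Q R hQR => hEd Q.2 R.2 fun h => hQR (Subtype.ext h))]
    _ ≤ _ := by gcongr 2 * ?_; exact setLIntegral_le_lintegral _ _

theorem iSup_indicator_box_min (v : (Fin d → ℝ) → ℝ≥0∞) (x : Fin d → ℝ) :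
    ⨆ n : ℕ, (Cube.box d n).toSet.indicator (fun x => min (v x) n) x = v x := by
  refine le_antisymm (iSup_le fun n => Set.indicator_le' (fun _ _ => min_le_left _ _)
    (fun _ _ => zero_le) x) ?_
  obtain ⟨m, hm⟩ := Set.mem_iUnion.1 (Cube.iUnion_box d ▸ Set.mem_univ x)
  calc v x = ⨆ n : ℕ, min (v x) n := by rw [← inf_iSup_eq, ENNReal.iSup_natCast, inf_top_eq]
    _ ≤ _ := by
      refine iSup_le fun n => le_trans ?_ (le_iSup _ (max n m))
      rw [Set.indicator_of_mem (Cube.box_mono d (le_max_right n m) hm)]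
      gcongr
      exact le_max_left n m

/-- A function whose products with the dual functions of `supNorm` are integrable has finite
`supNorm`. -/
theorem IsMaximalClass.supNorm_le_of_dual (hW : IsMaximalClass W B) (hp : 1 < p)
    {v : (Fin d → ℝ) → ℝ≥0∞} (hv : Measurable v) {c : ℝ≥0∞}
    (h : ∀ (g : (Fin d → ℝ) → ℝ≥0∞) (D : ℝ≥0∞), Measurable g →
      (∀ f : (Fin d → ℝ) → ℝ≥0∞, Measurable f → ∫⁻ x, g x * f x ≤ D * supNorm volume W p f) →
      ∫⁻ x, v x * g x ≤ c * D) : supNorm volume W p v ≤ c := by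
  have hp0 : 0 < p := by linarith
  have hpr : p.HolderConjugate p.conjExponent := Real.HolderConjugate.conjExponent hp
  set r := p.conjExponent
  refine supNorm_le hp0 fun k hk => ?_
  have hkm := hW.measurable k hk
  -- Truncation in height and support makes the integral of u_n^p k finite, as absorption requires.
  set u : ℕ → (Fin d → ℝ) → ℝ≥0∞ :=
    fun n => (Cube.box d n).toSet.indicator fun x => min (v x) n with hu
  have hum : ∀ n, Measurable (u n) := fun n =>
    (hv.min measurable_const).indicator (Cube.measurableSet_toSet _)
  have hun : ∀ n x, u n x ≤ v x := fun n x =>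
    Set.indicator_le' (fun _ _ => min_le_left _ _) (fun _ _ => zero_le) x
  have humono : Monotone u := by
    intro m n hmn x
    by_cases hx : x ∈ (Cube.box d m).toSet
    · simp only [hu, Set.indicator_of_mem hx, Set.indicator_of_mem (Cube.box_mono d hmn hx)]
      gcongr
    · simp only [hu, Set.indicator_of_notMem hx]; exact zero_le
  have hsup : ∀ x, v x ^ p * k x = ⨆ n, u n x ^ p * k x := by
    intro x
    have h := (ENNReal.orderIsoRpow p hp0).map_iSup fun n => u n x
    simp only [ENNReal.orderIsoRpow_apply] at h
    rw [← ENNReal.iSup_mul, ← h, hu, iSup_indicator_box_min]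
  simp_rw [hsup]
  rw [lintegral_iSup (fun n => ((hum n).pow_const p).fun_mul hkm)]
  swap
  · intro m n hmn x
    have := humono hmn x
    dsimp only
    gcongr
  refine iSup_le fun n => ENNReal.rpow_le_of_le_mul_rpow hpr ?_ ?_
  · obtain ⟨C, hC, hCk⟩ := hW.lintegral_le (Cube.box d n)
    refine (lt_of_le_of_lt (b := ∫⁻ x in (Cube.box d n).toSet, (n : ℝ≥0∞) ^ p * k x) ?_ ?_).ne
    · rw [← lintegral_indicator (Cube.measurableSet_toSet _)]
      refine lintegral_mono fun x => ?_
      by_cases hx : x ∈ (Cube.box d n).toSet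
      · simp only [hu, Set.indicator_of_mem hx]
        gcongr
        exact min_le_right _ _
      · simp only [hu, Set.indicator_of_notMem hx, ENNReal.zero_rpow_of_pos hp0, zero_mul, le_refl]
    · rw [lintegral_const_mul _ hkm]
      exact ENNReal.mul_lt_top (ENNReal.rpow_lt_top_of_nonneg hp0.le (ENNReal.natCast_ne_top n))
        ((hCk k hk).trans_lt hC.lt_top)
  · have hsplit : ∀ x, u n x ^ p * k x = u n x * (u n x ^ (p - 1) * k x) := by
      intro x
      rw [← mul_assoc]
      congr 1
      conv_lhs => rw [show p = 1 + (p - 1) by ring,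
        ENNReal.rpow_add_of_nonneg _ _ zero_le_one (by linarith), ENNReal.rpow_one]
    have hGm : Measurable fun x => u n x ^ (p - 1) := (hum n).pow_const _
    -- The extremal test function for Hölder: with J = ∫ u_n^p k, its dual bound D is J^(1/r), which
    -- gives J ≤ c J^(1/r).
    refine le_trans ?_ (h (fun x => u n x ^ (p - 1) * k x) _ (hGm.fun_mul hkm) fun f hf => ?_)
    · refine lintegral_mono fun x => ?_
      rw [hsplit]
      gcongr
      exact hun n x
    · have hpow : ∀ x, (u n x ^ (p - 1)) ^ r = u n x ^ p := fun x => by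
        rw [← ENNReal.rpow_mul, hpr.sub_one_mul_conj]
      calc ∫⁻ x, u n x ^ (p - 1) * k x * f x = ∫⁻ x, f x * u n x ^ (p - 1) * k x :=
            lintegral_congr fun x => by ring
        _ ≤ (∫⁻ x, f x ^ p * k x) ^ (1 / p) * (∫⁻ x, (u n x ^ (p - 1)) ^ r * k x) ^ (1 / r) :=
            lintegral_mul_mul_le_Lp_mul_Lq volume hpr hf hGm hkm
        _ ≤ (∫⁻ x, u n x ^ p * k x) ^ (1 / r) * supNorm volume W p f := by
            simp_rw [hpow]
            rw [mul_comm]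
            gcongr
            exact le_iSup₂ (f := fun k (_ : k ∈ W) => (∫⁻ x, f x ^ p * k x) ^ (1 / p)) k hk

theorem IsMaximalClass.supNorm_cubeSum_le (hW : IsMaximalClass W B) (hp : 1 < p) (hB : B ≠ ∞)
    {S : Set (Cube d)} (hS : Cube.IsSparse S) {f : (Fin d → ℝ) → ℝ≥0∞} (hf : Measurable f)
    (hρ : supNorm volume W p f ≠ ∞) :
    supNorm volume W p (cubeSum S f) ≤ 2 * (12 ^ d * 2 ^ d * 8 * ENNReal.ofReal p * B) *
      (12 ^ d * 2 ^ d * 2 * ENNReal.ofReal (p / (p - 1)) * B ^ (1 / p) * supNorm volume W p f) := by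
  refine hW.supNorm_le_of_dual hp (hS.measurable_cubeSum f) fun g D hg hD => ?_
  have hM := hW.supNorm_maxFn_le hp hf
  have hp0 : 0 ≤ 1 / p := by rw [one_div, inv_nonneg]; linarith
  calc ∫⁻ x, cubeSum S f x * g x ≤ 2 * ∫⁻ x, maxFn g x * maxFn f x :=
        hS.lintegral_cubeSum_mul_le f hg
    _ ≤ 2 * (12 ^ d * 2 ^ d * 8 * ENNReal.ofReal p * B * D * supNorm volume W p (maxFn f)) := by
        gcongr
        refine hW.lintegral_maxFn_mul_le hp hg (fun f hf _ => hD f hf) hB (measurable_maxFn f)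
          (hM.trans_lt ?_).ne
        have := ENNReal.rpow_ne_top_of_nonneg hp0 hB
        finiteness
    _ ≤ 2 * (12 ^ d * 2 ^ d * 8 * ENNReal.ofReal p * B * D * (12 ^ d * 2 ^ d * 2 *
        ENNReal.ofReal (p / (p - 1)) * B ^ (1 / p) * supNorm volume W p f)) := by gcongr
    _ = _ := by ring

end MaximalClass

/-! ### Köthe duality in quasi-Banach function spaces -/

namespace FunctionSpace

section General

variable {Ω : Type*} [MeasurableSpace Ω] {𝕜 : Type*} [RCLike 𝕜] {μ : Measure Ω}

theorem measurable_enorm_coe (f : Ω →ₘ[μ] 𝕜) : Measurable fun x => ‖f x‖ₑ :=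
  f.stronglyMeasurable.measurable.enorm

theorem Represents.enorm_ae_eq {f : Ω →ₘ[μ] 𝕜} {u : Ω → ℝ≥0∞} (h : Represents f u) :
    ∀ᵐ x ∂μ, ‖f x‖ₑ = u x := by
  filter_upwards [h] with x hx
  rw [hx.2, ← ofReal_norm, RCLike.norm_ofReal, abs_of_nonneg ENNReal.toReal_nonneg,
    ENNReal.ofReal_toReal hx.1]

theorem Represents.unique {f g : Ω →ₘ[μ] 𝕜} {u : Ω → ℝ≥0∞} (hf : Represents f u)
    (hg : Represents g u) : f = g := by
  refine AEEqFun.ext ?_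
  filter_upwards [hf, hg] with x hx hx'
  rw [hx.2, hx'.2]

theorem exists_represents {u : Ω → ℝ≥0∞} (hu : Measurable u) (hfin : ∀ᵐ x ∂μ, u x ≠ ∞) :
    ∃ f : Ω →ₘ[μ] 𝕜, Represents f u := by
  have hm : AEStronglyMeasurable (fun x => (((u x).toReal : ℝ) : 𝕜)) μ :=
    RCLike.continuous_ofReal.comp_aestronglyMeasurable hu.ennreal_toReal.aestronglyMeasurable
  refine ⟨AEEqFun.mk _ hm, ?_⟩
  filter_upwards [AEEqFun.coeFn_mk _ hm, hfin] with x hx hx'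
  exact ⟨hx', hx⟩

theorem enorm_absPow {r : ℝ} (hr : 0 ≤ r) (f : Ω →ₘ[μ] 𝕜) :
    ∀ᵐ x ∂μ, ‖absPow r f x‖ₑ = ‖f x‖ₑ ^ r := by
  have h : absPow r f =ᵐ[μ] fun x => ((‖f x‖ ^ r : ℝ) : 𝕜) := AEEqFun.coeFn_mk _ _
  filter_upwards [h] with x hx
  rw [hx, ← ofReal_norm, RCLike.norm_ofReal, abs_of_nonneg (by positivity),
    ← ENNReal.ofReal_rpow_of_nonneg (norm_nonneg _) hr, ofReal_norm]

variable {X : FunctionSpace 𝕜 μ}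

theorem IsQuasiBanach.ideal' (hX : X.IsQuasiBanach) {f g : Ω →ₘ[μ] 𝕜} (hf : f ∈ X.carrier)
    (h : ∀ᵐ x ∂μ, ‖g x‖ₑ ≤ ‖f x‖ₑ) : g ∈ X.carrier ∧ X.nrm g ≤ X.nrm f :=
  hX.ideal f hf g (h.mono fun _ hx => enorm_le_iff_norm_le.1 hx)

theorem IsQuasiBanach.sum_mem (hX : X.IsQuasiBanach) {ι : Type*} (s : Finset ι)
    {a : ι → Ω →ₘ[μ] 𝕜} (ha : ∀ i, a i ∈ X.carrier) : ∑ i ∈ s, a i ∈ X.carrier := by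
  classical
  induction s using Finset.induction_on with
  | empty => simpa using hX.zero_mem
  | insert i s hi ih => rw [Finset.sum_insert hi]; exact hX.add_mem _ (ha i) _ ih

/-- A series of nonnegative functions whose quasi-norms decay fast enough has a majorant. -/
theorem IsQuasiBanach.exists_majorant (hX : X.IsQuasiBanach) :
    ∃ ε : ℝ, 0 < ε ∧ ∀ f : ℕ → Ω →ₘ[μ] 𝕜, (∀ n, f n ∈ X.carrier) → (∀ n, X.nrm (f n) ≤ 1) →
      ∃ F ∈ X.carrier, ∀ n, ∀ᵐ x ∂μ, ENNReal.ofReal (ε ^ n) * ‖f n x‖ₑ ≤ ‖F x‖ₑ := by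
  obtain ⟨K₀, hK₀⟩ := hX.nrm_add_le
  set K : ℝ≥0 := max K₀ 1 with hKdef
  have hK1 : 1 ≤ K := le_max_right _ _
  have hK : ∀ f ∈ X.carrier, ∀ g ∈ X.carrier, X.nrm (f + g) ≤ K * (X.nrm f + X.nrm g) := by
    intro f hf g hg
    refine (hK₀ f hf g hg).trans ?_
    gcongr
    exact le_max_left _ _
  -- With Kε = 1/2 the tail bound 2Kε^m reproduces itself: K(2Kε^(m+1) + ε^m) = 2Kε^m.
  set ε : ℝ≥0 := (2 * K)⁻¹ with hε
  have hε0 : 0 < ε := by positivity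
  have hKε : (K : ℝ≥0∞) * (2 * K * ε) = K := by
    norm_cast
    rw [hε, mul_inv_cancel₀ (by positivity), mul_one]
  have hε1 : ε < 1 := by
    rw [hε]
    refine inv_lt_one_of_one_lt₀ ?_
    calc (1 : ℝ≥0) < 2 * 1 := by norm_num
      _ ≤ 2 * K := by gcongr
  refine ⟨ε, by exact_mod_cast hε0, fun f hf hf1 => ?_⟩
  have habs : ∀ n, ∀ᵐ x ∂μ, absPow 1 (f n) x = ((‖f n x‖ : ℝ) : 𝕜) := by
    intro n
    have h : absPow 1 (f n) =ᵐ[μ] fun x => ((‖f n x‖ ^ (1 : ℝ) : ℝ) : 𝕜) := AEEqFun.coeFn_mk _ _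
    filter_upwards [h] with x hx
    rw [hx, Real.rpow_one]
  set a : ℕ → Ω →ₘ[μ] 𝕜 := fun n => (((ε : ℝ) ^ n : ℝ) : 𝕜) • absPow 1 (f n) with ha
  have hae : ∀ n, ∀ᵐ x ∂μ, a n x = (((ε : ℝ) ^ n * ‖f n x‖ : ℝ) : 𝕜) := by
    intro n
    filter_upwards [AEEqFun.coeFn_smul (((ε : ℝ) ^ n : ℝ) : 𝕜) (absPow 1 (f n)), habs n]
      with x hx hx'
    rw [hx, Pi.smul_apply, hx', smul_eq_mul]
    push_cast
    rfl
  have habsX : ∀ n, absPow 1 (f n) ∈ X.carrier ∧ X.nrm (absPow 1 (f n)) ≤ X.nrm (f n) := by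
    intro n
    refine hX.ideal' (hf n) ?_
    filter_upwards [enorm_absPow zero_le_one (f n)] with x hx
    rw [hx, ENNReal.rpow_one]
  have haX : ∀ n, a n ∈ X.carrier := fun n => hX.smul_mem _ _ (habsX n).1
  have han : ∀ n, X.nrm (a n) ≤ (ε : ℝ≥0∞) ^ n := by
    intro n
    rw [ha]
    simp only
    rw [hX.nrm_smul _ _ (habsX n).1]
    have : ‖(((ε : ℝ) ^ n : ℝ) : 𝕜)‖ₑ = (ε : ℝ≥0∞) ^ n := by
      rw [← ofReal_norm, RCLike.norm_ofReal, abs_of_nonneg (by positivity),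
        ENNReal.ofReal_pow (by positivity), ENNReal.ofReal_coe_nnreal]
    rw [this]
    calc (ε : ℝ≥0∞) ^ n * X.nrm (absPow 1 (f n)) ≤ ε ^ n * 1 := by
          gcongr; exact (habsX n).2.trans (hf1 n)
      _ = _ := mul_one _
  have htail : ∀ j m, X.nrm (∑ i ∈ Finset.range j, a (m + i)) ≤ 2 * K * (ε : ℝ≥0∞) ^ m := by
    intro j
    induction j with
    | zero =>
      intro m
      rw [Finset.sum_range_zero, (hX.nrm_eq_zero_iff 0 hX.zero_mem).2 rfl]
      exact zero_le
    | succ j ih =>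
      intro m
      -- The largest term is split off first, so each further factor K meets a further factor ε.
      rw [Finset.sum_range_succ', add_zero]
      have h1 : ∑ i ∈ Finset.range j, a (m + (i + 1)) = ∑ i ∈ Finset.range j, a (m + 1 + i) :=
        Finset.sum_congr rfl fun i _ => by congr 1; ring
      rw [h1]
      calc X.nrm (∑ i ∈ Finset.range j, a (m + 1 + i) + a m)
          ≤ K * (X.nrm (∑ i ∈ Finset.range j, a (m + 1 + i)) + X.nrm (a m)) :=
            hK _ (hX.sum_mem _ fun i => haX _) _ (haX m)
        _ ≤ K * (2 * K * (ε : ℝ≥0∞) ^ (m + 1) + (ε : ℝ≥0∞) ^ m) := by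
            gcongr
            · exact ih (m + 1)
            · exact han m
        _ = (K * (2 * K * ε)) * ε ^ m + K * ε ^ m := by ring
        _ = 2 * K * ε ^ m := by rw [hKε]; ring
  set u : ℕ → Ω →ₘ[μ] 𝕜 := fun N => ∑ i ∈ Finset.range N, a i with hu
  have huX : ∀ N, u N ∈ X.carrier := fun N => hX.sum_mem _ haX
  have hdiff : ∀ m j, X.nrm (u (m + j) - u m) ≤ 2 * K * (ε : ℝ≥0∞) ^ m := by
    intro m j
    rw [hu]
    simp only [Finset.sum_range_add, add_sub_cancel_left]
    exact htail j m
  have hneg : ∀ g ∈ X.carrier, X.nrm (-g) ≤ X.nrm g := fun g hg =>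
    (hX.ideal' hg (by
      filter_upwards [AEEqFun.coeFn_neg g] with x hx
      rw [hx, Pi.neg_apply, enorm_neg])).2
  have hsub : ∀ f ∈ X.carrier, ∀ g ∈ X.carrier, f - g ∈ X.carrier := by
    intro f hf g hg
    rw [sub_eq_add_neg, ← neg_one_smul 𝕜 g]
    exact hX.add_mem _ hf _ (hX.smul_mem _ _ hg)
  have hdiff' : ∀ N m n, N ≤ m → N ≤ n → X.nrm (u m - u n) ≤ 2 * K * (ε : ℝ≥0∞) ^ N := by
    have h1 : ∀ N m n, N ≤ m → m ≤ n → X.nrm (u n - u m) ≤ 2 * K * (ε : ℝ≥0∞) ^ N := by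
      intro N m n hNm hmn
      obtain ⟨j, rfl⟩ := Nat.exists_eq_add_of_le hmn
      refine (hdiff m j).trans ?_
      gcongr 2 * K * ?_
      exact pow_le_pow_right_of_le_one' (by exact_mod_cast hε1.le) hNm
    intro N m n hm hn
    rcases le_total m n with h | h
    · rw [← neg_sub]
      exact (hneg _ (hsub _ (huX n) _ (huX m))).trans (h1 N m n hm h)
    · exact h1 N n m hn h
  have hpow : Tendsto (fun N : ℕ => 2 * K * (ε : ℝ≥0∞) ^ N) atTop (𝓝 0) := by
    have := ENNReal.Tendsto.const_mul (a := 2 * K)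
      (ENNReal.tendsto_pow_atTop_nhds_zero_of_lt_one
        (show (ε : ℝ≥0∞) < 1 by exact_mod_cast hε1)) (Or.inr (by finiteness))
    rwa [mul_zero] at this
  obtain ⟨F, hF, hFlim⟩ := hX.complete u huX fun δ hδ => by
    obtain ⟨N, hN⟩ := (hpow.eventually (gt_mem_nhds hδ)).exists
    exact ⟨N, fun m hm n hn => (hdiff' N m n hm hn).trans_lt hN⟩
  refine ⟨F, hF, fun n => ?_⟩
  have hgm : AEStronglyMeasurable
      (fun x => ((max ((ε : ℝ) ^ n * ‖f n x‖ - ‖F x‖) 0 : ℝ) : 𝕜)) μ :=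
    RCLike.continuous_ofReal.comp_aestronglyMeasurable
      (((f n).aestronglyMeasurable.norm.const_mul _).sub F.aestronglyMeasurable.norm |>.sup
        aestronglyMeasurable_const)
  -- The excess of ε^n |f_n| over |F| is dominated by |u_N - F| for every N > n, so its quasi-norm
  -- is zero. This uses the ideal property instead of a.e. convergence of the partial sums.
  set g : Ω →ₘ[μ] 𝕜 := AEEqFun.mk _ hgm with hg
  have hge : ∀ᵐ x ∂μ, g x = ((max ((ε : ℝ) ^ n * ‖f n x‖ - ‖F x‖) 0 : ℝ) : 𝕜) :=
    AEEqFun.coeFn_mk _ hgm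
  have hgle : ∀ N, n < N → g ∈ X.carrier ∧ X.nrm g ≤ X.nrm (u N - F) := by
    intro N hN
    refine hX.ideal _ (hsub _ (huX N) _ hF) g ?_
    have hsum : ∀ᵐ x ∂μ, u N x = ∑ i ∈ Finset.range N, a i x := by
      rw [hu]
      simp only
      generalize Finset.range N = s
      classical
      induction s using Finset.induction_on with
      | empty =>
        filter_upwards [AEEqFun.coeFn_zero (μ := μ) (α := Ω) (β := 𝕜)] with x hx
        simpa using hx
      | insert i s hi ih =>
        rw [Finset.sum_insert hi]
        filter_upwards [ih, AEEqFun.coeFn_add (a i) (∑ i ∈ s, a i)] with x hx hx'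
        rw [hx', Pi.add_apply, hx, Finset.sum_insert hi]
    filter_upwards [hge, hsum, ae_all_iff.2 hae, AEEqFun.coeFn_sub (u N) F] with x hx h1 h2 h3
    rw [hx, h3, Pi.sub_apply, RCLike.norm_ofReal, abs_of_nonneg (le_max_right _ _)]
    refine max_le ?_ (norm_nonneg _)
    refine le_trans ?_ (norm_sub_norm_le _ _)
    gcongr
    simp_rw [h1, h2]
    rw [← RCLike.ofReal_sum, RCLike.norm_ofReal]
    refine le_trans ?_ (le_abs_self _)
    exact Finset.single_le_sum (f := fun i => (ε : ℝ) ^ i * ‖f i x‖)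
      (fun i _ => by positivity) (Finset.mem_range.2 hN)
  have hg0 : X.nrm g = 0 := by
    refine le_antisymm (ge_of_tendsto hFlim ?_) zero_le
    filter_upwards [eventually_gt_atTop n] with N hN
    exact (hgle N hN).2
  rw [hX.nrm_eq_zero_iff g (hgle (n + 1) n.lt_succ_self).1] at hg0
  have hz : ∀ᵐ x ∂μ, g x = 0 := by
    rw [hg0]; exact AEEqFun.coeFn_zero
  filter_upwards [hge, hz] with x hx hx0
  rw [hx0, eq_comm, RCLike.ofReal_eq_zero] at hx
  have h5 : (ε : ℝ) ^ n * ‖f n x‖ ≤ ‖F x‖ := by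
    have := max_eq_right_iff.1 hx
    linarith
  rw [← ofReal_norm, ← ofReal_norm, ← ENNReal.ofReal_mul (by positivity)]
  exact ENNReal.ofReal_le_ofReal h5

/-- The uniform boundedness principle for the Köthe dual. -/
theorem IsQuasiBanach.koetheDual_nrm_ne_top (hX : X.IsQuasiBanach) {g : Ω →ₘ[μ] 𝕜}
    (hg : g ∈ X.koetheDual.carrier) : X.koetheDual.nrm g ≠ ∞ := by
  obtain ⟨ε, hε, hmaj⟩ := hX.exists_majorant
  intro htop
  -- Gliding hump: f_n pairs with g to more than n ε^(-n), so a common majorant F of the ε^n |f_n|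
  -- would pair to at least n for all n, contradicting integrability of F g.
  have h1 : ∀ n : ℕ, ∃ f ∈ X.carrier, X.nrm f = 1 ∧
      (n : ℝ≥0∞) * (ENNReal.ofReal (ε ^ n))⁻¹ < ∫⁻ x, ‖f x * g x‖ₑ ∂μ := by
    intro n
    have h2 : (n : ℝ≥0∞) * (ENNReal.ofReal (ε ^ n))⁻¹ < X.koetheDual.nrm g := by
      rw [htop]
      refine ENNReal.mul_lt_top (ENNReal.natCast_lt_top n) (ENNReal.inv_lt_top.2 ?_)
      exact ENNReal.ofReal_pos.2 (by positivity)
    simp only [koetheDual, lt_iSup_iff] at h2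
    obtain ⟨f, hf, hf1, h⟩ := h2
    exact ⟨f, hf, hf1, h⟩
  choose f hf hf1 hlt using h1
  obtain ⟨F, hF, hFle⟩ := hmaj f hf fun n => (hf1 n).le
  have hint : ∫⁻ x, ‖F x * g x‖ₑ ∂μ < ∞ := (hg F hF).2
  obtain ⟨n, hn⟩ := ENNReal.exists_nat_gt hint.ne
  refine lt_irrefl (n : ℝ≥0∞) ?_
  have hc0 : ENNReal.ofReal (ε ^ n) ≠ 0 := (ENNReal.ofReal_pos.2 (by positivity)).ne'
  calc (n : ℝ≥0∞) = ENNReal.ofReal (ε ^ n) * (n * (ENNReal.ofReal (ε ^ n))⁻¹) := by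
        rw [mul_left_comm, ENNReal.mul_inv_cancel hc0 ENNReal.ofReal_ne_top, mul_one]
    _ ≤ ENNReal.ofReal (ε ^ n) * ∫⁻ x, ‖f n x * g x‖ₑ ∂μ := by gcongr; exact (hlt n).le
    _ = ∫⁻ x, ENNReal.ofReal (ε ^ n) * ‖f n x * g x‖ₑ ∂μ :=
        (lintegral_const_mul' _ _ ENNReal.ofReal_ne_top).symm
    _ ≤ ∫⁻ x, ‖F x * g x‖ₑ ∂μ := by
        refine lintegral_mono_ae ?_
        filter_upwards [hFle n] with x hx
        rw [enorm_mul, enorm_mul, ← mul_assoc]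
        gcongr
    _ < n := hn

theorem IsQuasiBanach.lintegral_mul_le (hX : X.IsQuasiBanach) {f : Ω →ₘ[μ] 𝕜}
    (hf : f ∈ X.carrier) (g : Ω →ₘ[μ] 𝕜) :
    ∫⁻ x, ‖f x * g x‖ₑ ∂μ ≤ X.nrm f * X.koetheDual.nrm g := by
  by_cases h0 : X.nrm f = 0
  · rw [hX.nrm_eq_zero_iff f hf] at h0
    have hz : ∀ᵐ x ∂μ, f x = 0 := by rw [h0]; exact AEEqFun.coeFn_zero
    rw [lintegral_congr_ae (g := fun _ => 0) (by filter_upwards [hz] with x hx; simp [hx])]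
    simp
  have ht := (hX.nrm_lt_top f hf).ne
  set c : 𝕜 := (((X.nrm f).toReal⁻¹ : ℝ) : 𝕜) with hc
  have hce : ‖c‖ₑ = (X.nrm f)⁻¹ := by
    rw [hc, ← ofReal_norm, RCLike.norm_ofReal, abs_of_nonneg (by positivity),
      ENNReal.ofReal_inv_of_pos (ENNReal.toReal_pos h0 ht), ENNReal.ofReal_toReal ht]
  have h1 : X.nrm (c • f) = 1 := by
    rw [hX.nrm_smul c f hf, hce, ENNReal.inv_mul_cancel h0 ht]
  have h2 : ∫⁻ x, ‖(c • f) x * g x‖ₑ ∂μ ≤ X.koetheDual.nrm g :=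
    le_iSup_of_le (c • f) (le_iSup_of_le (hX.smul_mem c f hf) (le_iSup_of_le h1 le_rfl))
  have h3 : ∫⁻ x, ‖(c • f) x * g x‖ₑ ∂μ = (X.nrm f)⁻¹ * ∫⁻ x, ‖f x * g x‖ₑ ∂μ := by
    rw [← lintegral_const_mul' _ _ (ENNReal.inv_ne_top.2 h0)]
    refine lintegral_congr_ae ?_
    filter_upwards [AEEqFun.coeFn_smul c f] with x hx
    rw [hx, Pi.smul_apply, smul_eq_mul, mul_assoc, enorm_mul, hce]
  rw [h3] at h2
  calc ∫⁻ x, ‖f x * g x‖ₑ ∂μ = X.nrm f * ((X.nrm f)⁻¹ * ∫⁻ x, ‖f x * g x‖ₑ ∂μ) := by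
        rw [← mul_assoc, ENNReal.mul_inv_cancel h0 ht, one_mul]
    _ ≤ _ := by gcongr

/-- The infimum is attained because the element representing T f is unique, hence the same for every
admissible constant. -/
theorem boundedWith_opNorm (hX : X.IsQuasiBanach) {T : (Ω →ₘ[μ] 𝕜) → Ω → ℝ≥0∞}
    (hT : X.Bounded T) : X.BoundedWith T (X.opNorm T) := by
  obtain ⟨C₀, hC₀⟩ := hT
  intro f hf
  obtain ⟨h, hh, hrep, hle⟩ := hC₀ f hf
  refine ⟨h, hh, hrep, ?_⟩
  by_cases h0 : X.nrm f = 0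
  · rw [h0, mul_zero] at hle ⊢; exact hle
  rw [← ENNReal.div_le_iff h0 (hX.nrm_lt_top f hf).ne]
  refine le_sInf fun C hC => ?_
  obtain ⟨h', -, hrep', hle'⟩ := hC f hf
  rw [ENNReal.div_le_iff h0 (hX.nrm_lt_top f hf).ne, hrep.unique hrep']
  exact hle'

theorem bounded_and_opNorm_le {T : (Ω →ₘ[μ] 𝕜) → Ω → ℝ≥0∞} {C D : ℝ≥0∞}
    (h : X.BoundedWith T C) (hC : C ≠ ∞) (hCD : C ≤ D) : X.Bounded T ∧ X.opNorm T ≤ D :=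
  ⟨⟨C.toNNReal, by rwa [ENNReal.coe_toNNReal hC]⟩, (sInf_le h).trans hCD⟩

end General

end FunctionSpace

/-! ### Norm properties of a supremum of weighted L^p norms -/

section SupNorm

variable {Ω : Type*} [MeasurableSpace Ω] {μ : Measure Ω} {W : Set (Ω → ℝ≥0∞)} {p : ℝ}

theorem supNorm_mono_ae (hp : 0 < p) {u v : Ω → ℝ≥0∞} (h : ∀ᵐ x ∂μ, u x ≤ v x) :
    supNorm μ W p u ≤ supNorm μ W p v :=
  supNorm_le hp fun k hk => le_trans (lintegral_mono_ae (by
    filter_upwards [h] with x hx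
    gcongr)) (lintegral_rpow_le_supNorm hp v hk)

theorem supNorm_congr_ae (hp : 0 < p) {u v : Ω → ℝ≥0∞} (h : ∀ᵐ x ∂μ, u x = v x) :
    supNorm μ W p u = supNorm μ W p v :=
  le_antisymm (supNorm_mono_ae hp (h.mono fun _ => le_of_eq))
    (supNorm_mono_ae hp (h.mono fun _ => ge_of_eq))

theorem supNorm_zero (hp : 0 < p) : supNorm μ W p (fun _ => 0) = 0 :=
  le_antisymm (supNorm_le hp fun k _ => by simp [ENNReal.zero_rpow_of_pos hp]) zero_le

theorem supNorm_add_le (hp : 1 ≤ p) (hW : ∀ k ∈ W, Measurable k) {u v : Ω → ℝ≥0∞}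
    (hu : Measurable u) (hv : Measurable v) :
    supNorm μ W p (fun x => u x + v x) ≤ supNorm μ W p u + supNorm μ W p v := by
  refine iSup₂_le fun k hk => ?_
  have e : ∀ u : Ω → ℝ≥0∞, Measurable u →
      ∫⁻ x, u x ^ p ∂μ.withDensity k = ∫⁻ x, u x ^ p * k x ∂μ := fun u hu => by
    rw [lintegral_withDensity_eq_lintegral_mul _ (hW k hk) (hu.pow_const p)]
    simp_rw [Pi.mul_apply, mul_comm]
  have h := ENNReal.lintegral_Lp_add_le (μ := μ.withDensity k) hu.aemeasurable hv.aemeasurable hp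
  simp only [Pi.add_apply] at h
  rw [e _ (hu.fun_add hv), e _ hu, e _ hv] at h
  refine h.trans (add_le_add ?_ ?_)
  · exact le_iSup₂ (f := fun k (_ : k ∈ W) => (∫⁻ x, u x ^ p * k x ∂μ) ^ (1 / p)) k hk
  · exact le_iSup₂ (f := fun k (_ : k ∈ W) => (∫⁻ x, v x ^ p * k x ∂μ) ^ (1 / p)) k hk

theorem supNorm_const_mul (hp : 0 < p) {c : ℝ≥0∞} (hc : c ≠ ∞) (u : Ω → ℝ≥0∞) :
    supNorm μ W p (fun x => c * u x) = c * supNorm μ W p u := by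
  simp_rw [supNorm, ENNReal.mul_iSup]
  refine iSup_congr fun k => iSup_congr fun _ => ?_
  simp_rw [ENNReal.mul_rpow_of_nonneg _ _ hp.le, mul_assoc]
  rw [lintegral_const_mul' _ _ (ENNReal.rpow_ne_top_of_nonneg hp.le hc),
    ENNReal.mul_rpow_of_nonneg _ _ (by positivity), ← ENNReal.rpow_mul,
    mul_one_div_cancel hp.ne', ENNReal.rpow_one]

end SupNorm

/-! ### Function spaces normed by a maximal class -/

section MaximalClassSpaces

variable {d : ℕ} {W : Set ((Fin d → ℝ) → ℝ≥0∞)} {B : ℝ≥0∞} {p : ℝ}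

theorem ae_of_forall_box {P : (Fin d → ℝ) → Prop}
    (h : ∀ n, ∀ᵐ x, x ∈ (Cube.box d n).toSet → P x) : ∀ᵐ x, P x := by
  filter_upwards [ae_all_iff.2 h] with x hx
  obtain ⟨n, hn⟩ := Set.mem_iUnion.1 (Cube.iUnion_box d ▸ Set.mem_univ x)
  exact hx n hn

theorem ae_ne_top_of_forall_lintegral {u : (Fin d → ℝ) → ℝ≥0∞} (hu : Measurable u)
    (h : ∀ Q : Cube d, ∫⁻ x in Q.toSet, u x ≠ ∞) : ∀ᵐ x, u x ≠ ∞ := by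
  refine ae_of_forall_box fun n => ?_
  have := ae_lt_top hu (h (Cube.box d n))
  rw [ae_restrict_iff' (Cube.measurableSet_toSet _)] at this
  exact this.mono fun x hx hxn => (hx hxn).ne

theorem IsMaximalClass.ae_ne_top (hW : IsMaximalClass W B) (hp : 1 < p)
    {u : (Fin d → ℝ) → ℝ≥0∞} (hu : Measurable u) (hρ : supNorm volume W p u ≠ ∞) :
    ∀ᵐ x, u x ≠ ∞ :=
  ae_ne_top_of_forall_lintegral hu fun Q => hW.lintegral_ne_top hp hρ Q

theorem IsMaximalClass.supNorm_indicator_ne_top (hW : IsMaximalClass W B) (hp : 1 < p)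
    (Q : Cube d) : supNorm volume W p (Q.toSet.indicator 1) ≠ ∞ := by
  have hp0 : 0 < p := by linarith
  obtain ⟨C, hC, hCk⟩ := hW.lintegral_le Q
  refine ((supNorm_le hp0 (c := C ^ (1 / p)) fun k hk => ?_).trans_lt
    (ENNReal.rpow_lt_top_of_nonneg (by positivity) hC)).ne
  rw [← ENNReal.rpow_mul, one_div, inv_mul_cancel₀ hp0.ne', ENNReal.rpow_one]
  refine le_trans (le_of_eq ?_) (hCk k hk)
  rw [← lintegral_indicator Q.measurableSet_toSet]
  refine lintegral_congr fun x => ?_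
  by_cases hx : x ∈ Q.toSet <;> simp [hx, hp0]

/-- `supNorm` controls the unweighted `L^p` norms over cubes. -/
theorem IsMaximalClass.exists_Lp_le (hW : IsMaximalClass W B) (hp : 0 < p) (Q : Cube d) :
    ∃ C : ℝ≥0∞, C ≠ 0 ∧ C ≠ ∞ ∧ ∀ u : (Fin d → ℝ) → ℝ≥0∞, Measurable u →
      (∫⁻ x in Q.toSet, u x ^ p) ^ (1 / p) ≤ C * supNorm volume W p u := by
  obtain ⟨k, hk, ε, hε, hεt, hεk⟩ := hW.exists_ge Q
  refine ⟨ε⁻¹ ^ (1 / p), ?_, ?_, fun u hu => ?_⟩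
  · simp [ENNReal.rpow_eq_zero_iff, hε, hεt]
  · exact ENNReal.rpow_ne_top_of_nonneg (by positivity) (ENNReal.inv_ne_top.2 hε)
  · have h1 : ∫⁻ x in Q.toSet, u x ^ p ≤ ε⁻¹ * ∫⁻ x, u x ^ p * k x := by
      calc ∫⁻ x in Q.toSet, u x ^ p ≤ ∫⁻ x in Q.toSet, ε⁻¹ * (u x ^ p * k x) := by
            refine lintegral_mono_ae ((ae_restrict_iff' Q.measurableSet_toSet).2 ?_)
            filter_upwards [hεk] with x hx hxQ
            calc u x ^ p = ε⁻¹ * (u x ^ p * ε) := by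
                  rw [mul_left_comm, ENNReal.inv_mul_cancel hε hεt, mul_one]
              _ ≤ _ := by gcongr; exact hx hxQ
        _ = ε⁻¹ * ∫⁻ x in Q.toSet, u x ^ p * k x :=
            lintegral_const_mul' _ _ (ENNReal.inv_ne_top.2 hε)
        _ ≤ _ := by gcongr ε⁻¹ * ?_; exact setLIntegral_le_lintegral _ _
    calc (∫⁻ x in Q.toSet, u x ^ p) ^ (1 / p)
        ≤ (ε⁻¹ * ∫⁻ x, u x ^ p * k x) ^ (1 / p) := by gcongr
      _ = ε⁻¹ ^ (1 / p) * (∫⁻ x, u x ^ p * k x) ^ (1 / p) :=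
          ENNReal.mul_rpow_of_nonneg _ _ (by positivity)
      _ ≤ _ := by
          gcongr
          exact le_iSup₂ (f := fun k (_ : k ∈ W) => (∫⁻ x, u x ^ p * k x) ^ (1 / p)) k hk

namespace FunctionSpace

variable {𝕜 : Type*} [RCLike 𝕜] {Y : FunctionSpace 𝕜 (volume : Measure (Fin d → ℝ))}

/-- The quasi-norm of the space is given by `supNorm`. -/
structure IsSupNormSpace (Y : FunctionSpace 𝕜 (volume : Measure (Fin d → ℝ)))
    (W : Set ((Fin d → ℝ) → ℝ≥0∞)) (p : ℝ) : Prop where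
  mem_iff : ∀ f, f ∈ Y.carrier ↔ supNorm volume W p (fun x => ‖f x‖ₑ) ≠ ∞
  nrm_eq : ∀ f, f ∈ Y.carrier → Y.nrm f = supNorm volume W p (fun x => ‖f x‖ₑ)

theorem IsSupNormSpace.exists_represents (hY : Y.IsSupNormSpace W p) (hW : IsMaximalClass W B)
    (hp : 1 < p) {u : (Fin d → ℝ) → ℝ≥0∞} (hu : Measurable u)
    (hρ : supNorm volume W p u ≠ ∞) :
    ∃ f ∈ Y.carrier, Represents f u ∧ Y.nrm f = supNorm volume W p u := by
  obtain ⟨f, hf⟩ := FunctionSpace.exists_represents (𝕜 := 𝕜) hu (hW.ae_ne_top hp hu hρ)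
  have he := supNorm_congr_ae (W := W) (p := p) (by linarith) hf.enorm_ae_eq
  have hfY : f ∈ Y.carrier := (hY.mem_iff f).2 (he ▸ hρ)
  exact ⟨f, hfY, hf, (hY.nrm_eq f hfY).trans he⟩

theorem IsSupNormSpace.boundedWith (hY : Y.IsSupNormSpace W p) (hW : IsMaximalClass W B)
    (hp : 1 < p) {T : ((Fin d → ℝ) →ₘ[volume] 𝕜) → (Fin d → ℝ) → ℝ≥0∞}
    (hT : ∀ f, Measurable (T f)) {C : ℝ≥0∞} (hC : C ≠ ∞)
    (h : ∀ f ∈ Y.carrier, supNorm volume W p (T f) ≤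
      C * supNorm volume W p (fun x => ‖f x‖ₑ)) : Y.BoundedWith T C := by
  intro f hf
  have hft := (hY.mem_iff f).1 hf
  obtain ⟨g, hg, hrep, hn⟩ := hY.exists_represents hW hp (hT f)
    ((h f hf).trans_lt (ENNReal.mul_lt_top hC.lt_top hft.lt_top)).ne
  refine ⟨g, hg, hrep, ?_⟩
  rw [hn, hY.nrm_eq f hf]
  exact h f hf

/-- Riesz–Fischer: `supNorm` dominates unweighted L^p on boxes, so a rapidly Cauchy subsequence
converges a.e. Fatou's lemma, one weight at a time, upgrades this to convergence in norm. -/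
theorem IsSupNormSpace.exists_limit (hY : Y.IsSupNormSpace W p) (hW : IsMaximalClass W B)
    (hp : 1 < p) (hsub : ∀ f ∈ Y.carrier, ∀ g ∈ Y.carrier, f - g ∈ Y.carrier)
    (u : ℕ → ((Fin d → ℝ) →ₘ[volume] 𝕜)) (hu : ∀ n, u n ∈ Y.carrier)
    (hc : ∀ ε : ℝ≥0∞, 0 < ε → ∃ N, ∀ m ≥ N, ∀ n ≥ N, Y.nrm (u m - u n) < ε) :
    ∃ f ∈ Y.carrier, Tendsto (fun n => Y.nrm (u n - f)) atTop (𝓝 0) := by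
  have hp0 : 0 < p := by linarith
  have hc' : ∀ ε : ℝ≥0∞, 0 < ε → ∃ N, ∀ m ≥ N, ∀ n ≥ N,
      supNorm volume W p (fun x => ‖u m x - u n x‖ₑ) < ε := by
    intro ε hε
    obtain ⟨N, hN⟩ := hc ε hε
    refine ⟨N, fun m hm n hn => ?_⟩
    have h := hN m hm n hn
    rw [hY.nrm_eq _ (hsub _ (hu m) _ (hu n))] at h
    refine lt_of_le_of_lt (supNorm_congr_ae hp0 ?_).le h
    filter_upwards [AEEqFun.coeFn_sub (u m) (u n)] with x hx
    rw [hx, Pi.sub_apply]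
  choose N hN using fun j : ℕ => hc' (2⁻¹ ^ j) (by
    refine pos_iff_ne_zero.2 (pow_ne_zero _ ?_); norm_num)
  -- Partial sums of the N_i ensure N_j ≤ M_n for every j ≤ n.
  set M : ℕ → ℕ := fun j => ∑ i ∈ Finset.range (j + 1), N i with hM
  have hMN : ∀ j n, j ≤ n → N j ≤ M n := fun j n hjn =>
    Finset.single_le_sum (f := N) (fun _ _ => Nat.zero_le _) (Finset.mem_range.2 (by omega))
  have hlim : ∀ᵐ x, ∃ l : 𝕜, Tendsto (fun j => u (M j) x) atTop (𝓝 l) := by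
    refine ae_of_forall_box fun b => ?_
    rw [← ae_restrict_iff' (Cube.measurableSet_toSet _)]
    obtain ⟨C, hC0, hCt, hCu⟩ := hW.exists_Lp_le hp0 (Cube.box d b)
    refine Lp.ae_tendsto_of_cauchy_eLpNorm' (p := p) (B := fun j => C * 2⁻¹ ^ j)
      (fun n => (u (M n)).aestronglyMeasurable.restrict) hp.le ?_ fun j n m hn hm => ?_
    · rw [ENNReal.tsum_mul_left, ENNReal.tsum_geometric_two]
      finiteness
    · refine lt_of_le_of_lt (hCu (fun x => ‖u (M n) x - u (M m) x‖ₑ)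
        ((u (M n)).stronglyMeasurable.sub (u (M m)).stronglyMeasurable).measurable.enorm) ?_
      exact ENNReal.mul_lt_mul_right hC0 hCt (hN j _ (hMN j n hn) _ (hMN j m hm))
  obtain ⟨f₀, hf₀, hf₀lim⟩ := exists_stronglyMeasurable_limit_of_tendsto_ae
    (fun n => (u (M n)).aestronglyMeasurable) hlim
  set f : (Fin d → ℝ) →ₘ[volume] 𝕜 := AEEqFun.mk f₀ hf₀.aestronglyMeasurable with hf
  have hfe : ∀ᵐ x, f x = f₀ x := AEEqFun.coeFn_mk _ _
  have hest : ∀ j n, N j ≤ n → supNorm volume W p (fun x => ‖(u n - f) x‖ₑ) ≤ 2⁻¹ ^ j := by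
    intro j n hn
    refine supNorm_le hp0 fun k hk => ?_
    have hkm := hW.measurable k hk
    have hum : ∀ i, Measurable fun x => ‖u n x - u (M i) x‖ₑ := fun i =>
      ((u n).stronglyMeasurable.sub (u (M i)).stronglyMeasurable).measurable.enorm
    have hkt : ∀ᵐ x, k x ≠ ∞ := ae_ne_top_of_forall_lintegral hkm fun Q => by
      obtain ⟨C, hC, hCk⟩ := hW.lintegral_le Q
      exact ((hCk k hk).trans_lt hC.lt_top).ne
    calc ∫⁻ x, ‖(u n - f) x‖ₑ ^ p * k x
        = ∫⁻ x, liminf (fun i => ‖u n x - u (M i) x‖ₑ ^ p * k x) atTop := by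
          refine lintegral_congr_ae ?_
          filter_upwards [AEEqFun.coeFn_sub (u n) f, hfe, hf₀lim, hkt] with x h1 h2 h3 h4
          rw [h1, Pi.sub_apply, h2]
          refine (Tendsto.liminf_eq ?_).symm
          refine ENNReal.Tendsto.mul_const ?_ (Or.inr h4)
          exact (ENNReal.continuous_rpow_const.tendsto _).comp
            ((continuous_enorm.tendsto _).comp (tendsto_const_nhds.sub h3))
      _ ≤ liminf (fun i => ∫⁻ x, ‖u n x - u (M i) x‖ₑ ^ p * k x) atTop :=
          lintegral_liminf_le fun i => ((hum i).pow_const p).fun_mul hkm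
      _ ≤ (2⁻¹ ^ j) ^ p := by
          refine liminf_le_of_frequently_le' (Eventually.frequently ?_)
          filter_upwards [eventually_ge_atTop j] with i hi
          refine (lintegral_rpow_le_supNorm hp0 _ hk).trans ?_
          gcongr
          exact (hN j n hn _ (hMN j i hi)).le
  have hpow : Tendsto (fun j : ℕ => (2⁻¹ : ℝ≥0∞) ^ j) atTop (𝓝 0) :=
    ENNReal.tendsto_pow_atTop_nhds_zero_of_lt_one (by simp)
  have hmem : ∀ n, N 0 ≤ n → u n - f ∈ Y.carrier := fun n hn =>
    (hY.mem_iff _).2 ((hest 0 n hn).trans_lt (by simp)).ne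
  refine ⟨f, ?_, ?_⟩
  · have := hsub _ (hu (N 0)) _ (hmem (N 0) le_rfl)
    rwa [sub_sub_cancel] at this
  · refine ENNReal.tendsto_nhds_zero.2 fun ε hε => ?_
    obtain ⟨j, hj⟩ := (hpow.eventually (gt_mem_nhds hε)).exists
    filter_upwards [eventually_ge_atTop (max (N j) (N 0))] with n hn
    rw [hY.nrm_eq _ (hmem n ((le_max_right _ _).trans hn))]
    exact (hest j n ((le_max_left _ _).trans hn)).trans hj.le

theorem IsSupNormSpace.isQuasiBanach (hY : Y.IsSupNormSpace W p) (hW : IsMaximalClass W B)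
    (hp : 1 < p) : Y.IsQuasiBanach := by
  have hp0 : 0 < p := by linarith
  have hideal : ∀ f ∈ Y.carrier, ∀ g : (Fin d → ℝ) →ₘ[volume] 𝕜, (∀ᵐ x, ‖g x‖ ≤ ‖f x‖) →
      g ∈ Y.carrier ∧ Y.nrm g ≤ Y.nrm f := by
    intro f hf g hgf
    have h := supNorm_mono_ae (W := W) hp0 (hgf.mono fun x hx => enorm_le_iff_norm_le.2 hx)
    have hg : g ∈ Y.carrier := (hY.mem_iff g).2 (h.trans_lt ((hY.mem_iff f).1 hf).lt_top).ne
    exact ⟨hg, by rw [hY.nrm_eq g hg, hY.nrm_eq f hf]; exact h⟩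
  have hadd : ∀ f g : (Fin d → ℝ) →ₘ[volume] 𝕜, supNorm volume W p (fun x => ‖(f + g) x‖ₑ) ≤
      supNorm volume W p (fun x => ‖f x‖ₑ) + supNorm volume W p (fun x => ‖g x‖ₑ) := by
    intro f g
    refine le_trans (supNorm_mono_ae hp0 ?_) (supNorm_add_le hp.le hW.measurable
      (measurable_enorm_coe f) (measurable_enorm_coe g))
    filter_upwards [AEEqFun.coeFn_add f g] with x hx
    rw [hx]
    exact enorm_add_le _ _
  have hadd_mem : ∀ f ∈ Y.carrier, ∀ g ∈ Y.carrier, f + g ∈ Y.carrier := by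
    intro f hf g hg
    exact (hY.mem_iff _).2 ((hadd f g).trans_lt (ENNReal.add_lt_top.2
      ⟨((hY.mem_iff f).1 hf).lt_top, ((hY.mem_iff g).1 hg).lt_top⟩)).ne
  have hsmul : ∀ (c : 𝕜) (f : (Fin d → ℝ) →ₘ[volume] 𝕜),
      supNorm volume W p (fun x => ‖(c • f) x‖ₑ) =
        ‖c‖ₑ * supNorm volume W p (fun x => ‖f x‖ₑ) := by
    intro c f
    rw [← supNorm_const_mul hp0 enorm_ne_top]
    refine supNorm_congr_ae hp0 ?_
    filter_upwards [AEEqFun.coeFn_smul c f] with x hx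
    rw [hx, Pi.smul_apply, smul_eq_mul, enorm_mul]
  have hsmul_mem : ∀ (c : 𝕜), ∀ f ∈ Y.carrier, c • f ∈ Y.carrier := by
    intro c f hf
    rw [hY.mem_iff, hsmul]
    exact ENNReal.mul_ne_top enorm_ne_top ((hY.mem_iff f).1 hf)
  have hzero : supNorm volume W p (fun x => ‖(0 : (Fin d → ℝ) →ₘ[volume] 𝕜) x‖ₑ) = 0 := by
    rw [← supNorm_zero (μ := volume) (W := W) hp0]
    refine supNorm_congr_ae hp0 ?_
    filter_upwards [AEEqFun.coeFn_zero (μ := volume) (α := Fin d → ℝ) (β := 𝕜)] with x hx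
    simp [hx]
  have hzero_mem : (0 : (Fin d → ℝ) →ₘ[volume] 𝕜) ∈ Y.carrier := by
    rw [hY.mem_iff, hzero]; exact ENNReal.zero_ne_top
  refine
    { zero_mem := hzero_mem
      add_mem := hadd_mem
      smul_mem := hsmul_mem
      nrm_lt_top := fun f hf => by rw [hY.nrm_eq f hf]; exact ((hY.mem_iff f).1 hf).lt_top
      nrm_eq_zero_iff := fun f hf => ?_
      nrm_smul := fun c f hf => by rw [hY.nrm_eq f hf, hY.nrm_eq _ (hsmul_mem c f hf), hsmul]
      nrm_add_le := ⟨1, fun f hf g hg => by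
        rw [hY.nrm_eq f hf, hY.nrm_eq g hg, hY.nrm_eq _ (hadd_mem f hf g hg), ENNReal.coe_one,
          one_mul]
        exact hadd f g⟩
      complete := fun u hu hc => hY.exists_limit hW hp (fun f hf g hg => by
        rw [sub_eq_add_neg, ← neg_one_smul 𝕜 g]
        exact hadd_mem _ hf _ (hsmul_mem _ _ hg)) u hu hc
      ideal := hideal
      saturation := fun E hE hE0 => ?_ }
  · refine ⟨fun h => ?_, fun h => by rw [hY.nrm_eq f hf, h, hzero]⟩
    rw [hY.nrm_eq f hf] at h
    refine AEEqFun.ext ?_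
    have h0 : ∀ᵐ x, f x = 0 := by
      refine ae_of_forall_box fun n => ?_
      obtain ⟨C, -, -, hC⟩ := hW.exists_Lp_le hp0 (Cube.box d n)
      have h1 := hC _ (measurable_enorm_coe f)
      rw [h, mul_zero, nonpos_iff_eq_zero, ENNReal.rpow_eq_zero_iff_of_pos (by positivity),
        lintegral_eq_zero_iff ((measurable_enorm_coe f).pow_const p), EventuallyEq,
        ae_restrict_iff' (Cube.measurableSet_toSet _)] at h1
      filter_upwards [h1] with x hx hxn
      have := hx hxn
      simpa [ENNReal.rpow_eq_zero_iff_of_pos hp0] using this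
    filter_upwards [h0, AEEqFun.coeFn_zero (μ := volume) (α := Fin d → ℝ) (β := 𝕜)] with x hx hx'
    rw [hx, hx', Pi.zero_apply]
  · have h1 : ∃ n, 0 < volume (E ∩ (Cube.box d n).toSet) := by
      by_contra! hcon
      have h2 : volume (⋃ n, E ∩ (Cube.box d n).toSet) = 0 :=
        measure_iUnion_null fun n => nonpos_iff_eq_zero.1 (hcon n)
      rw [← Set.inter_iUnion, Cube.iUnion_box, Set.inter_univ] at h2
      exact hE0.ne' h2
    obtain ⟨n, hn⟩ := h1
    have hFm : MeasurableSet (E ∩ (Cube.box d n).toSet) := hE.inter (Cube.measurableSet_toSet _)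
    obtain ⟨f, hf, hrep, -⟩ := hY.exists_represents hW hp
      (u := (E ∩ (Cube.box d n).toSet).indicator 1) (measurable_one.indicator hFm)
      ((supNorm_mono_ae hp0 (ae_of_all _ (Set.indicator_le_indicator_of_subset
        Set.inter_subset_right fun _ => zero_le))).trans_lt
          (hW.supNorm_indicator_ne_top hp (Cube.box d n)).lt_top).ne
    exact ⟨_, Set.inter_subset_left, hFm, hn, f, hf, hrep⟩

/-- The maximal operator on the Köthe dual of a `supNorm` space. -/
theorem IsSupNormSpace.koetheDual_boundedWith_maximalOp (hY : Y.IsSupNormSpace W p)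
    (hW : IsMaximalClass W B) (hp : 1 < p) (hB : B ≠ ∞) :
    Y.koetheDual.BoundedWith maximalOp (12 ^ d * 2 ^ d * 8 * ENNReal.ofReal p * B) := by
  have hp0 : 0 < p := by linarith
  have hYq := hY.isQuasiBanach hW hp
  intro g hg
  have hDt := hYq.koetheDual_nrm_ne_top hg
  set D := Y.koetheDual.nrm g
  set C : ℝ≥0∞ := 12 ^ d * 2 ^ d * 8 * ENNReal.ofReal p * B with hC
  have hCt : C ≠ ∞ := by rw [hC]; finiteness
  have hD : ∀ f : (Fin d → ℝ) → ℝ≥0∞, Measurable f → supNorm volume W p f ≠ ∞ →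
      ∫⁻ x, ‖g x‖ₑ * f x ≤ D * supNorm volume W p f := by
    intro f hf hρ
    obtain ⟨f', hf', hrep, hn⟩ := hY.exists_represents hW hp hf hρ
    have h := hYq.lintegral_mul_le hf' g
    rw [hn, mul_comm] at h
    refine le_trans (lintegral_congr_ae ?_).le h
    filter_upwards [hrep.enorm_ae_eq] with x hx
    rw [enorm_mul, hx, mul_comm]
  have hM : ∀ f : (Fin d → ℝ) → ℝ≥0∞, Measurable f → supNorm volume W p f ≠ ∞ →
      ∫⁻ x, maximalOp g x * f x ≤ C * D * supNorm volume W p f := fun f hf hρ =>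
    hW.lintegral_maxFn_mul_le hp (measurable_enorm_coe g) hD hB hf hρ
  have hMm : Measurable (maximalOp g) := measurable_maxFn _
  -- Testing the dual estimate on indicators of cubes shows that the maximal function of g is
  -- locally integrable, hence finite a.e.
  obtain ⟨h, hrep⟩ := FunctionSpace.exists_represents (𝕜 := 𝕜) hMm
    (ae_ne_top_of_forall_lintegral hMm fun Q => by
      have h1 := hM (Q.toSet.indicator 1) (measurable_one.indicator Q.measurableSet_toSet)
        (hW.supNorm_indicator_ne_top hp Q)
      have h2 : ∫⁻ x in Q.toSet, maximalOp g x =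
          ∫⁻ x, maximalOp g x * Q.toSet.indicator 1 x := by
        rw [← lintegral_indicator Q.measurableSet_toSet]
        refine lintegral_congr fun x => ?_
        by_cases hx : x ∈ Q.toSet <;> simp [hx]
      rw [h2]
      exact (h1.trans_lt (ENNReal.mul_lt_top (ENNReal.mul_lt_top hCt.lt_top hDt.lt_top)
        (hW.supNorm_indicator_ne_top hp Q).lt_top)).ne)
  have hpair : ∀ f ∈ Y.carrier, ∫⁻ x, ‖f x * h x‖ₑ ≤ C * D * Y.nrm f := by
    intro f hf
    rw [hY.nrm_eq f hf]
    refine le_trans (lintegral_congr_ae ?_).le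
      (hM _ (measurable_enorm_coe f) ((hY.mem_iff f).1 hf))
    filter_upwards [hrep.enorm_ae_eq] with x hx
    rw [enorm_mul, hx, mul_comm]
  refine ⟨h, fun f hf => ⟨f.aestronglyMeasurable.mul h.aestronglyMeasurable, ?_⟩, hrep, ?_⟩
  · exact (hpair f hf).trans_lt (ENNReal.mul_lt_top (ENNReal.mul_lt_top hCt.lt_top hDt.lt_top)
      (hYq.nrm_lt_top f hf))
  · refine iSup_le fun f => iSup_le fun hf => iSup_le fun hf1 => ?_
    have := hpair f hf
    rwa [hf1, mul_one] at this

/-- The absolute values of the elements of the unit ball. -/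
def unitBallWeights {Ω : Type*} [MeasurableSpace Ω] {μ : Measure Ω} (X : FunctionSpace 𝕜 μ) :
    Set (Ω → ℝ≥0∞) :=
  {k | Measurable k ∧ ∃ f ∈ X.carrier, X.nrm f ≤ 1 ∧ ∀ᵐ x ∂μ, k x = ‖f x‖ₑ}

/-- The weights are the unit ball because the dual norm of |f|^p is the supremum of ∫ |f|^p |k| over
it. That membership forces a finite norm is the uniform boundedness principle
`IsQuasiBanach.koetheDual_nrm_ne_top`. -/
theorem isSupNormSpace_power_koetheDual {X : FunctionSpace 𝕜 (volume : Measure (Fin d → ℝ))}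
    (hX : X.IsQuasiBanach) {θ : ℝ} (hθ : 0 < θ) :
    (X.koetheDual.power θ).IsSupNormSpace X.unitBallWeights (1 / θ) := by
  set p := 1 / θ with hp
  have hp0 : 0 < p := by positivity
  have hpow : ∀ f : (Fin d → ℝ) →ₘ[volume] 𝕜, ∀ k : (Fin d → ℝ) →ₘ[volume] 𝕜,
      ∫⁻ x, ‖k x * absPow p f x‖ₑ = ∫⁻ x, ‖f x‖ₑ ^ p * ‖k x‖ₑ := by
    intro f k
    refine lintegral_congr_ae ?_
    filter_upwards [enorm_absPow hp0.le f] with x hx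
    rw [enorm_mul, hx, mul_comm]
  have hle : ∀ f : (Fin d → ℝ) →ₘ[volume] 𝕜,
      X.koetheDual.nrm (absPow p f) ≤
        supNorm volume X.unitBallWeights p (fun x => ‖f x‖ₑ) ^ p := by
    intro f
    refine iSup_le fun k => iSup_le fun hk => iSup_le fun hk1 => ?_
    rw [hpow]
    exact lintegral_rpow_le_supNorm hp0 _
      ⟨measurable_enorm_coe k, k, hk, hk1.le, ae_of_all _ fun _ => rfl⟩
  have hθp : ∀ a : ℝ≥0∞, (a ^ θ) ^ p = a := fun a => by
    rw [← ENNReal.rpow_mul, hp, mul_one_div_cancel hθ.ne', ENNReal.rpow_one]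
  have hpθ : ∀ a : ℝ≥0∞, (a ^ p) ^ θ = a := fun a => by
    rw [← ENNReal.rpow_mul, hp, one_div_mul_cancel hθ.ne', ENNReal.rpow_one]
  have heq : ∀ f : (Fin d → ℝ) →ₘ[volume] 𝕜,
      (X.koetheDual.power θ).nrm f = supNorm volume X.unitBallWeights p (fun x => ‖f x‖ₑ) := by
    intro f
    refine le_antisymm ?_ (supNorm_le hp0 fun k hk => ?_)
    · calc (X.koetheDual.power θ).nrm f = X.koetheDual.nrm (absPow p f) ^ θ := rfl
        _ ≤ (supNorm volume X.unitBallWeights p (fun x => ‖f x‖ₑ) ^ p) ^ θ :=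
            ENNReal.rpow_le_rpow (hle f) hθ.le
        _ = _ := hpθ _
    · obtain ⟨-, k', hk', hk1, hkk'⟩ := hk
      change _ ≤ (X.koetheDual.nrm (absPow p f) ^ θ) ^ p
      rw [hθp]
      calc ∫⁻ x, ‖f x‖ₑ ^ p * k x = ∫⁻ x, ‖k' x * absPow p f x‖ₑ := by
            rw [hpow]
            refine lintegral_congr_ae ?_
            filter_upwards [hkk'] with x hx
            rw [hx]
        _ ≤ X.nrm k' * X.koetheDual.nrm (absPow p f) := hX.lintegral_mul_le hk' _
        _ ≤ 1 * X.koetheDual.nrm (absPow p f) := by gcongr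
        _ = _ := one_mul _
  refine ⟨fun f => ⟨fun hf => ?_, fun hf => ?_⟩, fun f _ => heq f⟩
  · rw [← heq]
    exact ENNReal.rpow_ne_top_of_nonneg hθ.le (hX.koetheDual_nrm_ne_top hf)
  · intro k hk
    refine ⟨k.aestronglyMeasurable.mul (absPow p f).aestronglyMeasurable, ?_⟩
    refine (hX.lintegral_mul_le hk _).trans_lt (ENNReal.mul_lt_top (hX.nrm_lt_top k hk) ?_)
    exact (hle f).trans_lt (ENNReal.rpow_lt_top_of_nonneg hp0.le hf)

/-! ### The unit ball of X as a maximal class -/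

section UnitBall

variable {X : FunctionSpace 𝕜 (volume : Measure (Fin d → ℝ))} {C : ℝ≥0∞}

/-- Saturation gives some nonzero f in X. On a large box containing Q its maximal function is
bounded below by a positive constant, and the ideal property then puts the indicator of Q in X. -/
theorem IsQuasiBanach.exists_indicator (hX : X.IsQuasiBanach) (hC : X.BoundedWith maximalOp C)
    (Q : Cube d) : ∃ χ ∈ X.carrier, X.nrm χ ≠ 0 ∧ ∀ᵐ x, ‖χ x‖ₑ = Q.toSet.indicator 1 x := by
  have huniv : (0 : ℝ≥0∞) < volume (Set.univ : Set (Fin d → ℝ)) :=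
    (pos_iff_ne_zero.2 (Cube.box d 0).volume_ne_zero).trans_le (measure_mono (Set.subset_univ _))
  obtain ⟨F, -, hFm, hF0, f, hf, hrep⟩ := hX.saturation _ MeasurableSet.univ huniv
  have hfne : ¬ ∀ᵐ x, ‖f x‖ₑ = 0 := by
    intro h
    refine hF0.ne' (measure_eq_zero_iff_ae_notMem.2 ?_)
    filter_upwards [h, hrep.enorm_ae_eq] with x hx hx' hxF
    rw [hx', Set.indicator_of_mem hxF] at hx
    exact one_ne_zero hx
  obtain ⟨m, hm⟩ := Q.exists_subset_box
  have h1 : ∃ n ≥ m, ∫⁻ x in (Cube.box d n).toSet, ‖f x‖ₑ ≠ 0 := by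
    by_contra! hcon
    refine hfne (ae_of_forall_box fun n => ?_)
    have h2 := hcon (max n m) (le_max_right _ _)
    rw [lintegral_eq_zero_iff (measurable_enorm_coe f), EventuallyEq,
      ae_restrict_iff' (Cube.measurableSet_toSet _)] at h2
    filter_upwards [h2] with x hx hxn
    exact hx (Cube.box_mono d (le_max_left n m) hxn)
  obtain ⟨n, hnm, hn0⟩ := h1
  obtain ⟨h, hh, hhrep, -⟩ := hC f hf
  set a := (Cube.box d n).lavg fun x => ‖f x‖ₑ with ha
  have ha0 : a ≠ 0 := fun h0 => hn0 (by rw [← Cube.volume_mul_lavg, ← ha, h0, mul_zero])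
  have hah : ∀ᵐ x, x ∈ Q.toSet → a ≤ ‖h x‖ₑ := by
    filter_upwards [hhrep.enorm_ae_eq] with x hx hxQ
    rw [hx]
    exact lavg_le_maxFn _ (Cube.box_mono d hnm (hm hxQ))
  have hat : a ≠ ∞ := by
    intro hat
    refine Q.volume_ne_zero (measure_eq_zero_iff_ae_notMem.2 ?_)
    filter_upwards [hah] with x hx hxQ
    exact absurd (hx hxQ) (by rw [hat]; exact not_le.2 enorm_lt_top)
  obtain ⟨χ, hχ⟩ := FunctionSpace.exists_represents (𝕜 := 𝕜) (μ := volume)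
    (u := Q.toSet.indicator 1) (measurable_one.indicator Q.measurableSet_toSet)
    (ae_of_all _ fun x => by by_cases hx : x ∈ Q.toSet <;> simp [hx])
  have hχX : χ ∈ X.carrier := by
    refine (hX.ideal' (hX.smul_mem ((a.toReal⁻¹ : ℝ) : 𝕜) h hh) ?_).1
    filter_upwards [hχ.enorm_ae_eq, hah, AEEqFun.coeFn_smul ((a.toReal⁻¹ : ℝ) : 𝕜) h]
      with x hx hx' hx''
    rw [hx, hx'', Pi.smul_apply, smul_eq_mul, enorm_mul]
    by_cases hxQ : x ∈ Q.toSet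
    · rw [Set.indicator_of_mem hxQ, ← ofReal_norm, RCLike.norm_ofReal,
        abs_of_nonneg (by positivity), ENNReal.ofReal_inv_of_pos (ENNReal.toReal_pos ha0 hat),
        ENNReal.ofReal_toReal hat]
      calc (1 : ℝ≥0∞) = a⁻¹ * a := (ENNReal.inv_mul_cancel ha0 hat).symm
        _ ≤ _ := by gcongr; exact hx' hxQ
    · rw [Set.indicator_of_notMem hxQ]; exact zero_le
  refine ⟨χ, hχX, fun h0 => ?_, hχ.enorm_ae_eq⟩
  rw [hX.nrm_eq_zero_iff χ hχX] at h0
  have hz : ∀ᵐ x, χ x = 0 := by rw [h0]; exact AEEqFun.coeFn_zero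
  refine Q.volume_ne_zero (measure_eq_zero_iff_ae_notMem.2 ?_)
  filter_upwards [hz, hχ.enorm_ae_eq] with x hx hx' hxQ
  rw [hx, Set.indicator_of_mem hxQ] at hx'
  simp at hx'

/-- The function equal to the average of |f| on Q and zero elsewhere lies below the maximal function
of f. This is what makes the weights uniformly integrable on Q. -/
theorem IsQuasiBanach.lavg_mul_nrm_le (hX : X.IsQuasiBanach) (hC : X.BoundedWith maximalOp C)
    {Q : Cube d} {χ : (Fin d → ℝ) →ₘ[volume] 𝕜} (hχ : χ ∈ X.carrier)
    (hχQ : ∀ᵐ x, ‖χ x‖ₑ = Q.toSet.indicator 1 x) {f : (Fin d → ℝ) →ₘ[volume] 𝕜}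
    (hf : f ∈ X.carrier) :
    Q.lavg (fun x => ‖f x‖ₑ) ≠ ∞ ∧ Q.lavg (fun x => ‖f x‖ₑ) * X.nrm χ ≤ C * X.nrm f := by
  obtain ⟨h, hh, hrep, hle⟩ := hC f hf
  set a := Q.lavg fun x => ‖f x‖ₑ
  have hah : ∀ᵐ x, x ∈ Q.toSet → a ≤ ‖h x‖ₑ := by
    filter_upwards [hrep.enorm_ae_eq] with x hx hxQ
    rw [hx]
    exact lavg_le_maxFn _ hxQ
  have hat : a ≠ ∞ := by
    intro hat
    refine Q.volume_ne_zero (measure_eq_zero_iff_ae_notMem.2 ?_)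
    filter_upwards [hah] with x hx hxQ
    exact absurd (hx hxQ) (by rw [hat]; exact not_le.2 enorm_lt_top)
  have hae : ‖((a.toReal : ℝ) : 𝕜)‖ₑ = a := by
    rw [← ofReal_norm, RCLike.norm_ofReal, abs_of_nonneg (by positivity),
      ENNReal.ofReal_toReal hat]
  refine ⟨hat, le_trans ?_ hle⟩
  rw [← hae, ← hX.nrm_smul _ _ hχ]
  refine (hX.ideal' hh ?_).2
  filter_upwards [hah, hχQ, AEEqFun.coeFn_smul ((a.toReal : ℝ) : 𝕜) χ] with x hx hx' hx''
  rw [hx'', Pi.smul_apply, smul_eq_mul, enorm_mul, hx', hae]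
  by_cases hxQ : x ∈ Q.toSet
  · rw [Set.indicator_of_mem hxQ, Pi.one_apply, mul_one]; exact hx hxQ
  · rw [Set.indicator_of_notMem hxQ, mul_zero]; exact zero_le

theorem IsQuasiBanach.ne_zero_of_boundedWith (hX : X.IsQuasiBanach)
    (hC : X.BoundedWith maximalOp C) : C ≠ 0 := by
  obtain ⟨χ, hχ, hχ0, hχQ⟩ := hX.exists_indicator hC (Cube.box d 0)
  rintro rfl
  have h := (hX.lavg_mul_nrm_le hC hχ hχQ hχ).2
  rw [zero_mul, nonpos_iff_eq_zero, mul_eq_zero, or_iff_left hχ0] at h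
  have h1 := Cube.volume_mul_lavg (fun x => ‖χ x‖ₑ) (Cube.box d 0)
  rw [h, mul_zero, eq_comm, lintegral_congr_ae (ae_restrict_of_ae hχQ),
    lintegral_indicator_one (Cube.measurableSet_toSet _),
    Measure.restrict_apply_self] at h1
  exact Cube.volume_ne_zero _ h1

/-- The weight k' is C⁻¹ times the maximal function of k, which stays in the unit ball. The
normalized indicator of Q is the weight bounded below on Q. -/
theorem IsQuasiBanach.isMaximalClass_unitBallWeights (hX : X.IsQuasiBanach)
    (hC : X.BoundedWith maximalOp C) (hCt : C ≠ ∞) : IsMaximalClass X.unitBallWeights C := by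
  have hC0 := hX.ne_zero_of_boundedWith hC
  have hscale : ∀ {a : ℝ≥0∞}, a ≠ 0 → a ≠ ∞ → ‖((a.toReal⁻¹ : ℝ) : 𝕜)‖ₑ = a⁻¹ := by
    intro a ha hat
    rw [← ofReal_norm, RCLike.norm_ofReal, abs_of_nonneg (by positivity),
      ENNReal.ofReal_inv_of_pos (ENNReal.toReal_pos ha hat), ENNReal.ofReal_toReal hat]
  refine ⟨fun k hk => hk.1, fun k hk => ?_, fun Q => ?_, fun Q => ?_⟩
  · obtain ⟨hkm, f, hf, hf1, hkf⟩ := hk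
    obtain ⟨h, hh, hrep, hle⟩ := hC f hf
    set g := ((C.toReal⁻¹ : ℝ) : 𝕜) • h with hg
    have hge : ∀ᵐ x, ‖g x‖ₑ = C⁻¹ * ‖h x‖ₑ := by
      filter_upwards [AEEqFun.coeFn_smul ((C.toReal⁻¹ : ℝ) : 𝕜) h] with x hx
      rw [hg, hx, Pi.smul_apply, smul_eq_mul, enorm_mul, hscale hC0 hCt]
    refine ⟨fun x => ‖g x‖ₑ, ⟨measurable_enorm_coe g, g, hX.smul_mem _ _ hh, ?_,
      ae_of_all _ fun _ => rfl⟩, ?_⟩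
    · rw [hg, hX.nrm_smul _ _ hh, hscale hC0 hCt]
      calc C⁻¹ * X.nrm h ≤ C⁻¹ * (C * 1) := by
            gcongr
            refine hle.trans ?_
            gcongr
        _ = 1 := by rw [mul_one, ENNReal.inv_mul_cancel hC0 hCt]
    · rw [maxFn_congr_ae hkf]
      filter_upwards [hge, hrep.enorm_ae_eq] with x hx hx'
      rw [hx, ← mul_assoc, ENNReal.mul_inv_cancel hC0 hCt, one_mul, hx']
      exact le_rfl
  · obtain ⟨χ, hχ, hχ0, hχQ⟩ := hX.exists_indicator hC Q
    have hχt := (hX.nrm_lt_top χ hχ).ne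
    refine ⟨volume Q.toSet * (C * (X.nrm χ)⁻¹), ENNReal.mul_ne_top Q.volume_ne_top
      (ENNReal.mul_ne_top hCt (ENNReal.inv_ne_top.2 hχ0)), fun k hk => ?_⟩
    obtain ⟨hkm, f, hf, hf1, hkf⟩ := hk
    rw [lintegral_congr_ae (ae_restrict_of_ae hkf), ← Cube.volume_mul_lavg]
    gcongr
    rw [← div_eq_mul_inv, ENNReal.le_div_iff_mul_le (Or.inl hχ0) (Or.inl hχt)]
    refine (hX.lavg_mul_nrm_le hC hχ hχQ hf).2.trans ?_
    calc C * X.nrm f ≤ C * 1 := by gcongr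
      _ = C := mul_one C
  · obtain ⟨χ, hχ, hχ0, hχQ⟩ := hX.exists_indicator hC Q
    have hχt := (hX.nrm_lt_top χ hχ).ne
    set g := (((X.nrm χ).toReal⁻¹ : ℝ) : 𝕜) • χ with hg
    refine ⟨fun x => ‖g x‖ₑ, ⟨measurable_enorm_coe g, g, hX.smul_mem _ _ hχ, ?_,
      ae_of_all _ fun _ => rfl⟩, (X.nrm χ)⁻¹, ENNReal.inv_ne_zero.2 hχt,
      ENNReal.inv_ne_top.2 hχ0, ?_⟩
    · rw [hg, hX.nrm_smul _ _ hχ, hscale hχ0 hχt, ENNReal.inv_mul_cancel hχ0 hχt]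
    · filter_upwards [AEEqFun.coeFn_smul (((X.nrm χ).toReal⁻¹ : ℝ) : 𝕜) χ, hχQ] with x hx hx' hxQ
      rw [hg, hx, Pi.smul_apply, smul_eq_mul, enorm_mul, hscale hχ0 hχt, hx',
        Set.indicator_of_mem hxQ, Pi.one_apply, mul_one]

end UnitBall

end FunctionSpace

end MaximalClassSpaces

/-! ### The theorem, with p = 1/θ -/

theorem mainTheorem7 (d : ℕ) (hd : 1 ≤ d) :
    ∃ c : ℝ, 0 < c ∧
      ∀ (𝕜 : Type*) [RCLike 𝕜] (X : FunctionSpace 𝕜 (volume : Measure (Fin d → ℝ))),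
        X.IsQuasiBanach → X.HasFatou → X.Bounded maximalOp →
        ∀ θ : ℝ, 0 < θ → θ < 1 →
          ((X.koetheDual.power θ).Bounded maximalOp ∧
            (X.koetheDual.power θ).opNorm maximalOp ≤
              ENNReal.ofReal (c * (1 / (1 - θ))) * X.opNorm maximalOp ^ θ) ∧
          ((X.koetheDual.power θ).koetheDual.Bounded maximalOp ∧
            (X.koetheDual.power θ).koetheDual.opNorm maximalOp ≤
              ENNReal.ofReal (c * (1 / θ)) * X.opNorm maximalOp) ∧
          ((X.koetheDual.power θ).MemASparse ∧
            (X.koetheDual.power θ).sparseConst ≤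
              ENNReal.ofReal (c * (1 / θ) * (1 / (1 - θ))) * X.opNorm maximalOp ^ (1 + θ)) := by
  obtain ⟨a, ha1, hae⟩ : ∃ a : ℝ, 1 ≤ a ∧ ENNReal.ofReal a = 12 ^ d * 2 ^ d := by
    refine ⟨12 ^ d * 2 ^ d, one_le_mul_of_one_le_of_one_le (one_le_pow₀ (by norm_num))
      (one_le_pow₀ (by norm_num)), ?_⟩
    rw [ENNReal.ofReal_mul (by positivity), ENNReal.ofReal_pow (by norm_num),
      ENNReal.ofReal_pow (by norm_num), ENNReal.ofReal_ofNat, ENNReal.ofReal_ofNat]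
  have ha0 : 0 < a := by linarith
  -- With a = 12^d 2^d the three bounds carry the constants 2a, 8a and 2 · 8a · 2a = 32a²; the last
  -- dominates the others since a ≥ 1.
  refine ⟨32 * a ^ 2, by positivity, fun 𝕜 _ X hX _ hM θ hθ0 hθ1 => ?_⟩
  have hB := FunctionSpace.boundedWith_opNorm hX hM
  have hBt : X.opNorm maximalOp ≠ ∞ := by
    obtain ⟨C, hC⟩ := hM
    exact ((sInf_le hC).trans_lt ENNReal.coe_lt_top).ne
  set B := X.opNorm maximalOp
  have hB0 : B ≠ 0 := hX.ne_zero_of_boundedWith hB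
  have hW := hX.isMaximalClass_unitBallWeights hB hBt
  have hY := FunctionSpace.isSupNormSpace_power_koetheDual hX hθ0
  have hp : 1 < 1 / θ := by rwa [lt_div_iff₀ hθ0, one_mul]
  have h1θ : 0 < 1 - θ := by linarith
  have hBθ : B ^ θ ≠ ∞ := ENNReal.rpow_ne_top_of_nonneg hθ0.le hBt
  have hconj : 1 / θ / (1 / θ - 1) = 1 / (1 - θ) := by field_simp
  have h2 : (2 : ℝ≥0∞) = ENNReal.ofReal 2 := ENNReal.ofReal_ofNat 2 |>.symm
  have h8 : (8 : ℝ≥0∞) = ENNReal.ofReal 8 := ENNReal.ofReal_ofNat 8 |>.symm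
  set A : ℝ≥0∞ := 12 ^ d * 2 ^ d * 2 * ENNReal.ofReal (1 / (1 - θ)) * B ^ θ with hA
  set D : ℝ≥0∞ := 12 ^ d * 2 ^ d * 8 * ENNReal.ofReal (1 / θ) * B with hD
  have hAt : A ≠ ∞ := by rw [hA]; finiteness
  have hDt : D ≠ ∞ := by rw [hD]; finiteness
  have hMA : ∀ h : (Fin d → ℝ) → ℝ≥0∞, Measurable h →
      supNorm volume X.unitBallWeights (1 / θ) (maxFn h) ≤
        A * supNorm volume X.unitBallWeights (1 / θ) h := by
    intro h hh
    have := hW.supNorm_maxFn_le hp hh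
    rwa [hconj, one_div_one_div] at this
  have hsparse : (X.koetheDual.power θ).SparseBoundedWith (2 * D * A) := by
    intro S hS
    refine hY.boundedWith hW hp (fun f => hS.measurable_cubeSum _) (by finiteness) fun f hf => ?_
    have := hW.supNorm_cubeSum_le hp hBt hS (FunctionSpace.measurable_enorm_coe f)
      ((hY.mem_iff f).1 hf)
    rw [hconj, one_div_one_div, ← hD, ← hA, ← mul_assoc] at this
    exact this
  refine ⟨?_, ?_, ⟨hY.isQuasiBanach hW hp, (2 * D * A).toNNReal, ?_⟩, ?_⟩
  · refine FunctionSpace.bounded_and_opNorm_le (C := A) (hY.boundedWith hW hp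
      (fun f => measurable_maxFn _) hAt fun f _ => hMA _ (FunctionSpace.measurable_enorm_coe f))
      hAt ?_
    rw [hA, ← hae, h2, ← ENNReal.ofReal_mul (by positivity), ← ENNReal.ofReal_mul (by positivity)]
    gcongr ENNReal.ofReal (?_ * _) * _
    nlinarith
  · refine FunctionSpace.bounded_and_opNorm_le (hY.koetheDual_boundedWith_maximalOp hW hp hBt)
      hDt ?_
    rw [← hae, h8, ← ENNReal.ofReal_mul (by positivity), ← ENNReal.ofReal_mul (by positivity)]
    gcongr ENNReal.ofReal (?_ * _) * _
    nlinarith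
  · rwa [ENNReal.coe_toNNReal (by finiteness)]
  -- The exponent 1 + θ comes from B in D and B^θ in A; splitting the power uses that B is neither 0
  -- nor ∞.
  · refine (sInf_le hsparse).trans (le_of_eq ?_)
    rw [hA, hD, ← hae, ENNReal.rpow_add _ _ hB0 hBt, ENNReal.rpow_one,
      show 32 * a ^ 2 * (1 / θ) * (1 / (1 - θ)) =
        2 * (a * 8 * (1 / θ)) * (a * 2 * (1 / (1 - θ))) by ring,
      ENNReal.ofReal_mul (by positivity), ENNReal.ofReal_mul (by positivity),
      ENNReal.ofReal_mul (by positivity), ENNReal.ofReal_mul (by positivity),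
      ENNReal.ofReal_mul (by positivity), ENNReal.ofReal_mul (by positivity), ← h2, ← h8]
    ring
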